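/- Let $n\ge 1$ and $N=n^2$. Write $\bar k=2n+1-k$ and let $W\subset\mathfrak S_{2n}$ be the Weyl group of type $C_n$, i.e. the group of permutations of $\{1,\dots,n,\bar n,\dots,\bar 1\}$ commuting with $k\mapsto\bar k$, with simple reflections $s_v=(v\ v{+}1)(\overline{v{+}1}\ \bar v)$ for $v<n$ and $s_n=(n\ \bar n)$, and longest element $w_0:k\mapsto\bar k$, of length $N$. Let $\mathbf i=(i_1,\dots,i_N)$ be a reduced word for $w_0$. The symplectic wiring diagram $G^{\rm symp}(\mathbf i)$ consists of $2n$ wires $\ell_1,\dots,\ell_n,\ell_{\bar n},\dots,\ell_{\bar 1}$, which are in this order from left to right at the top; at the $j$-th height from the top there are crossings (nodes) in columns $i_j$ and $2n-i_j$ (a single one, in column $n$, if $i_j=n$). It is symmetric with respect to the central vertical line. Let $L_r$ be the lower end of $\ell_r$. For $1\le k\le n$ orient $\ell_1,\dots,\ell_k$ upward and all other wires downward. A rigorous path in $G^{\rm symp}(\mathbf i,k)$ is an oriented path from $L_k$ to $L_{k+1}$ that passes through each node at most once and contains no forbidden fragment; a forbidden fragment is a straight passage along one wire through a node from right to left when both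 wires at the node are oriented downward or both upward. Let $\mathcal{GP}^{\rm symp}(\mathbf i,k)$ be the set of these paths. The mirror $P^\vee$ of a path $P$ is its reflection in the central vertical line, traversed backwards: if $P$ runs along $\ell_{r_1}\to\cdots\to\ell_{r_{s+1}}$, then $P^\vee$ runs along $\ell_{\overline{r_{s+1}}}\to\cdots\to\ell_{\overline{r_1}}$. A path is symmetric if $P=P^\vee$ (only possible for $k=n$). For $P\in\mathcal{GP}^{\rm symp}(\mathbf i,k)$ and a node $d$ let $A_d=1$ (resp. $-1$) if at $d$ the path $P$ changes from a wire $\ell_r$ to a wire $\ell_s$ with $r<s$ (resp. $r>s$), and $A_d=0$ otherwise. For $\mathbf a\in\mathbb R^N$ put $\hat F_P(\mathbf a)=\sum_d A_d\,c_d\,a_{j(d)}$, where $j(d)$ is the height of $d$, $c_d=2$ if $i_{j(d)}=n$ and $c_d=1$ otherwise. Define $F_P^{(C)}=\tfrac12\hat F_P$ if $P$ is symmetric and $F_P^{(C)}=\hat F_P$ otherwise. The type-$C$ description of the string cone of $\mathbf i$ is the system of inequalities $F_Q^{(C)}(\mathbf a)\ge 0$, indexed by all $1\le k\le n$ and all $Q\in\mathcal{GP}^{\rm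 symp}(\mathbf i,k)$. One of these inequalities is called non-redundant if deleting it (that is, deleting its index $(k,Q)$) from the system changes the set of solutions in $\mathbb R^N$. Let $P\in\mathcal{GP}^{\rm symp}(\mathbf i,n)$. Then the inequality $F_P^{(C)}(\mathbf a)\ge 0$ is non-redundant in the type-$C$ description of the string cone if and only if $P$ is symmetric. Moreover, if $P$ is not symmetric, then there are two distinct symmetric paths $Q_1,Q_2\in\mathcal{GP}^{\rm symp}(\mathbf i,n)$ such that $F_P^{(C)}=F_{Q_1}^{(C)}+F_{Q_2}^{(C)}$ as functions on $\mathbb R^N$. -/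

import Mathlib

namespace SympString

/-! ## Reduced words for the longest element of type `C_n`

The Weyl group of type `C_n` is realised as the group of permutations of the `2n` labels
`1, …, n, n̄, …, 1̄` (with `k̄ = 2n + 1 - k`) that commute with `k ↦ k̄`. Labels are the elements
of `Fin (2 * n)`, the label `k` being the element with value `k - 1`, so that `k̄` is `Fin.rev k`. -/

/-- The simple reflection `s_{v+1}` of type `C_n`: the product of the adjacent transpositions in the
columns `v + 1` and `2n - (v + 1)`; these columns coincide for `v + 1 = n`, and then `s_n` is the
single transposition in column `n`. -/
def simpleReflection (n : ℕ) (v : Fin n) : Equiv.Perm (Fin (2 * n)) :=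
  let p : Fin (2 * n) := ⟨v.val, by omega⟩
  let q : Fin (2 * n) := ⟨v.val + 1, by omega⟩
  if v.val + 1 = n then Equiv.swap p q else Equiv.swap p q * Equiv.swap q.rev p.rev

/-- The product of the first `h` simple reflections of the word `i`. -/
def prefixProd {n : ℕ} (i : Fin (n ^ 2) → Fin n) (h : ℕ) : Equiv.Perm (Fin (2 * n)) :=
  (((List.ofFn i).take h).map (simpleReflection n)).prod

/-- `i` is a reduced word for the longest element `w₀ : k ↦ k̄` of type `C_n`: a word of length
`n ^ 2 = ℓ(w₀)` whose product is `w₀`. The letter `v : Fin n` stands for the index `v + 1`. -/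
def IsReducedWord {n : ℕ} (i : Fin (n ^ 2) → Fin n) : Prop :=
  ((List.ofFn i).map (simpleReflection n)).prod = Fin.revPerm

/-! ## The symplectic wiring diagram

The diagram has `n ^ 2` layers of crossings, numbered from top to bottom. The `j`-th layer has a
crossing in column `i_j` and one in column `2n - i_j` (one single crossing if `i_j = n`). Between
the layers there are `n ^ 2 + 1` levels, level `0` on top and level `n ^ 2` at the bottom; layer `j`
lies between the levels `j` and `j + 1` (numbering from `0`). -/

/-- A piece of wire: the one at a given level and a given horizontal position
(counted from the left). -/
abbrev Strand (n : ℕ) : Type := Fin (n ^ 2 + 1) × Fin (2 * n)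

/-- The wire to which a strand belongs. On top, the wires are in their natural order. -/
def wire {n : ℕ} (i : Fin (n ^ 2) → Fin n) (x : Strand n) : Fin (2 * n) :=
  prefixProd i x.1.val x.2

/-- The nodes (crossings) of the diagram: pairs of a layer and the left one of the two positions
that are exchanged at the crossing. -/
abbrev Node {n : ℕ} (i : Fin (n ^ 2) → Fin n) : Type :=
  {d : Fin (n ^ 2) × Fin (2 * n) // d.2 < simpleReflection n (i d.1) d.2}

namespace Node

variable {n : ℕ} {i : Fin (n ^ 2) → Fin n}

/-- The layer of a node. -/
def layer (d : Node i) : Fin (n ^ 2) := d.1.1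

/-- The left position at a node. -/
def left (d : Node i) : Fin (2 * n) := d.1.2

/-- The right position at a node. -/
def right (d : Node i) : Fin (2 * n) := simpleReflection n (i d.1.1) d.1.2

end Node

/-! ## Orientation and rigorous paths -/

/-- In the `k`-th oriented diagram the wires `ℓ_1, …, ℓ_k` are oriented upward, the other ones
downward. -/
def IsUp {n : ℕ} (k : ℕ) (r : Fin (2 * n)) : Prop := r.val + 1 ≤ k

/-- Following its orientation, the strand `x` runs into layer `j`. -/
def Enters {n : ℕ} (i : Fin (n ^ 2) → Fin n) (k : ℕ) (j : Fin (n ^ 2)) (x : Strand n) : Prop :=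
  (IsUp k (wire i x) ∧ x.1 = j.succ) ∨ (¬ IsUp k (wire i x) ∧ x.1 = j.castSucc)

/-- Following its orientation, the strand `x` comes out of layer `j`. -/
def Leaves {n : ℕ} (i : Fin (n ^ 2) → Fin n) (k : ℕ) (j : Fin (n ^ 2)) (x : Strand n) : Prop :=
  (IsUp k (wire i x) ∧ x.1 = j.castSucc) ∨ (¬ IsUp k (wire i x) ∧ x.1 = j.succ)

/-- `x`, `y` are two strands at the node `d`, the first one oriented towards `d` and the second one
oriented away from `d` (they may belong to the same wire or to the two different wires at `d`). -/
def PassesNode {n : ℕ} (i : Fin (n ^ 2) → Fin n) (k : ℕ) (d : Node i) (x y : Strand n) : Prop :=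
  Enters i k d.layer x ∧ Leaves i k d.layer y ∧
    (x.2 = d.left ∨ x.2 = d.right) ∧ (y.2 = d.left ∨ y.2 = d.right)

/-- The forbidden fragments: the two wires at the node `d` are both oriented downward, or both
oriented upward, and the path goes straight through `d` from the right to the left (from the upper
right to the lower left, respectively from the lower right to the upper left). The two wires
are read off at the level just above `d`. -/
def IsForbidden {n : ℕ} (i : Fin (n ^ 2) → Fin n) (k : ℕ) (d : Node i) (x y : Strand n) : Prop :=
  (IsUp k (wire i (d.layer.castSucc, d.left)) ↔ IsUp k (wire i (d.layer.castSucc, d.right))) ∧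
    x.2 = d.right ∧ y.2 = d.left

/-- The strands `x`, `y` may follow each other in a rigorous path: either both are pieces of one
wire that takes part in no crossing of the layer between them, or they meet at a node that is passed
without a forbidden fragment. -/
def IsStep {n : ℕ} (i : Fin (n ^ 2) → Fin n) (k : ℕ) (x y : Strand n) : Prop :=
  (∃ j : Fin (n ^ 2), Enters i k j x ∧ Leaves i k j y ∧ x.2 = y.2 ∧
    simpleReflection n (i j) x.2 = x.2) ∨
  (∃ d : Node i, PassesNode i k d x y ∧ ¬ IsForbidden i k d x y)

/-- The path `P`, as the list of the strands along it, passes through the node `d` between its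
`b`-th and its `(b + 1)`-st strand. -/
def PassesAt {n : ℕ} (i : Fin (n ^ 2) → Fin n) (k : ℕ) (P : List (Strand n)) (d : Node i)
    (b : ℕ) : Prop :=
  ∃ h : b + 1 < P.length, PassesNode i k d P[b] P[b + 1]

/-- `x` is the lower end `L_r` of the wire `ℓ_r`. -/
def IsLowerEnd {n : ℕ} (i : Fin (n ^ 2) → Fin n) (r : ℕ) (x : Strand n) : Prop :=
  x.1 = Fin.last (n ^ 2) ∧ (wire i x).val + 1 = r

/-- Rigorous paths in the `k`-th oriented symplectic wiring diagram. -/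
structure IsRigorousPath {n : ℕ} (i : Fin (n ^ 2) → Fin n) (k : ℕ) (P : List (Strand n)) :
    Prop where
  /-- `P` starts at `L_k`. -/
  starts : ∃ x, P.head? = some x ∧ IsLowerEnd i k x
  /-- `P` ends at `L_{k+1}`. -/
  ends : ∃ x, P.getLast? = some x ∧ IsLowerEnd i (k + 1) x
  /-- `P` is a path that respects the orientation and has no forbidden fragment. -/
  isChain : P.IsChain (IsStep i k)
  /-- `P` passes through each node at most once. -/
  node_once : ∀ (d : Node i) (b c : ℕ), PassesAt i k P d b → PassesAt i k P d c → b = c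

/-- The set of rigorous paths in the `k`-th oriented symplectic wiring diagram. -/
def rigorousPaths {n : ℕ} (i : Fin (n ^ 2) → Fin n) (k : ℕ) : Set (List (Strand n)) :=
  {P | IsRigorousPath i k P}

/-! ## Mirrors -/

/-- The mirror `P^∨`: the path is reflected in the wall (the central vertical line) and traversed in
the opposite direction. If `P` runs along the wires `ℓ_{r_1} → ⋯ → ℓ_{r_{s+1}}`, then `P^∨` runs
along `ℓ_{r̄_{s+1}} → ⋯ → ℓ_{r̄_1}`, see `wire_mirror`. -/
def mirror {n : ℕ} (P : List (Strand n)) : List (Strand n) :=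
  (P.map fun x => (x.1, x.2.rev)).reverse

/-- A path is symmetric if it is equal to its mirror. -/
def IsSymmetric {n : ℕ} (P : List (Strand n)) : Prop := P = mirror P

theorem simpleReflection_rev (n : ℕ) (v : Fin n) (p : Fin (2 * n)) :
    simpleReflection n v p.rev = (simpleReflection n v p).rev := by
  have hv := v.isLt
  have hp := p.isLt
  apply Fin.ext
  unfold simpleReflection
  split_ifs with h
  · simp only [Equiv.swap_apply_def, Fin.ext_iff, Fin.val_rev, apply_ite Fin.val]
    split_ifs <;> omega
  · simp only [Equiv.Perm.mul_apply, Equiv.swap_apply_def, Fin.ext_iff, Fin.val_rev,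
      apply_ite Fin.val]
    split_ifs <;> omega

theorem wire_mirror {n : ℕ} (i : Fin (n ^ 2) → Fin n) (P : List (Strand n)) :
    (mirror P).map (wire i) = ((P.map (wire i)).map Fin.rev).reverse := by
  have key : ∀ (l : List (Fin n)) (p : Fin (2 * n)),
      (l.map (simpleReflection n)).prod p.rev = ((l.map (simpleReflection n)).prod p).rev := by
    intro l
    induction l with
    | nil => intro p; rfl
    | cons v l ih => intro p; simp [Equiv.Perm.mul_apply, ih, simpleReflection_rev]
  simp only [mirror, List.map_reverse, List.map_map]
  congr 1
  apply List.map_congr_left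
  intro x _
  exact key _ _

/-! ## String inequalities of type `C_n` -/

/-- `P` travels at the node `d` from the wire `r` to the wire `s`. -/
def Travels {n : ℕ} (i : Fin (n ^ 2) → Fin n) (k : ℕ) (P : List (Strand n)) (d : Node i)
    (r s : Fin (2 * n)) : Prop :=
  ∃ (b : ℕ) (h : b + 1 < P.length),
    PassesNode i k d P[b] P[b + 1] ∧ wire i P[b] = r ∧ wire i P[b + 1] = s

open Classical in
/-- The coefficient of the coordinate of the node `d` in the string inequality of `P`. -/
noncomputable def coeff {n : ℕ} (i : Fin (n ^ 2) → Fin n) (k : ℕ) (P : List (Strand n))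
    (d : Node i) : ℝ :=
  if ∃ r s, r < s ∧ Travels i k P d r s then 1
  else if ∃ r s, s < r ∧ Travels i k P d r s then -1
  else 0

/-- The string function of type `A_{2n-1}`, a linear function of one variable per node. -/
noncomputable def stringFunctionA {n : ℕ} (i : Fin (n ^ 2) → Fin n) (k : ℕ) (P : List (Strand n))
    (t : Node i → ℝ) : ℝ :=
  ∑ d : Node i, coeff i k P d * t d

/-- The substitution of `a_j` for both node coordinates `t_j`, `t̄_j` of layer `j` if `i_j ≠ n`,
and of `2 a_j` for the single node coordinate `t_j` of layer `j` if `i_j = n`. -/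
def unfoldCoords {n : ℕ} (i : Fin (n ^ 2) → Fin n) (a : Fin (n ^ 2) → ℝ) : Node i → ℝ :=
  fun d => if (i d.layer).val + 1 = n then 2 * a d.layer else a d.layer

open Classical in
/-- The string function `F_P^{(C)}` of type `C_n` of a path `P` in the `k`-th oriented diagram. -/
noncomputable def stringFunctionC {n : ℕ} (i : Fin (n ^ 2) → Fin n) (k : ℕ) (P : List (Strand n))
    (a : Fin (n ^ 2) → ℝ) : ℝ :=
  if IsSymmetric P then (1 / 2) * stringFunctionA i k P (unfoldCoords i a)
  else stringFunctionA i k P (unfoldCoords i a)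

/-- The index set of the description of the string cone of type `C_n`: pairs of `1 ≤ k ≤ n` and a
rigorous path in the `k`-th oriented diagram. -/
def indexSet {n : ℕ} (i : Fin (n ^ 2) → Fin n) : Set (ℕ × List (Strand n)) :=
  {q | 1 ≤ q.1 ∧ q.1 ≤ n ∧ q.2 ∈ rigorousPaths i q.1}

/-- The solution set of the inequalities `F_q^{(C)} ≥ 0` for `q ∈ S`. For `S = indexSet i` this is
the description of the string cone of type `C_n`. -/
def solutionSet {n : ℕ} (i : Fin (n ^ 2) → Fin n) (S : Set (ℕ × List (Strand n))) :
    Set (Fin (n ^ 2) → ℝ) :=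
  {a | ∀ q ∈ S, 0 ≤ stringFunctionC i q.1 q.2 a}

/-- The inequality of the path `P` in the `k`-th oriented diagram is non-redundant in the
description of the string cone: without it, the inequalities describe a different set. -/
def IsNonRedundant {n : ℕ} (i : Fin (n ^ 2) → Fin n) (k : ℕ) (P : List (Strand n)) : Prop :=
  solutionSet i (indexSet i \ {(k, P)}) ≠ solutionSet i (indexSet i)

end SympString

namespace SympString

/-! ## Simple reflections -/

/-! Everything happens for `k = n`. The label involution then exchanges upward and downward wires,
so reflecting in the wall and reversing preserves rigorous paths. In the diagram of a reduced word
the upper left wire at a node has the smaller label. This follows from an inversion count in which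
the `n ^ 2` letters must each contribute the maximum. At a node on the wall the two wires are mirror
images, so the left one is upward and the right one downward: both incoming strands lie on the right
and both outgoing ones on the left. Since `L_n` is right of the wall and `L_{n+1}` left of it, every
path crosses the wall exactly once and has the form `A ++ mirror B`, where `A` and `B` are half
paths from `L_n` to the same central node.

The paths `A ++ mirror A` and `B ++ mirror B` are again rigorous, and they are symmetric. Each half
contributes equally to itself and to its mirror, and the terms at the central node average
correctly. Hence the function of `A ++ mirror B` is the mean of the type-A functions of these two
paths, that is, the sum of their type-C functions. This is the decomposition
(`exists_symmetric_decomposition`), and it makes nonsymmetric inequalities redundant.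

For a symmetric `P`, a vector is needed that violates its inequality and no other. A path is encoded
by the symmetric difference of its strands with the upward strands. Read downward, this is a family
of occupied strands whose behaviour at each node is forced by the occupation above it, except when
only the upper left strand is occupied; then the coefficient is 0 or 1 (`IsRigorousPath.hasTrace`).
So at the first layer where two paths differ, their coefficients are 0 and 1. Rapidly decreasing
layer weights, with signs read off from `P`, therefore make `P` the strict minimum among symmetric
paths (`exists_gap`).

An odd potential on the labels shifts all functions with `k = n` by one prescribed constant and all
those with `k < n` by another (`exists_shift`). After the shift `P` has value -1/4, the other
symmetric paths have at least 1/4, and the functions for `k < n` are nonnegative. A nonsymmetric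
path is a sum of two distinct symmetric ones, so at most one summand is negative and the sum is
nonnegative. -/

theorem simpleReflection_val {n : ℕ} (v : Fin n) (p : Fin (2 * n)) :
    (simpleReflection n v p).val =
      if p.val = v.val then v.val + 1 else if p.val = v.val + 1 then v.val
      else if p.val = 2 * n - 1 - v.val then 2 * n - 2 - v.val
      else if p.val = 2 * n - 2 - v.val then 2 * n - 1 - v.val else p.val := by
  have hv := v.isLt
  have hp := p.isLt
  unfold simpleReflection
  split_ifs with h
  all_goals
    simp only [Equiv.Perm.mul_apply, Equiv.swap_apply_def, Fin.ext_iff, Fin.val_rev,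
      apply_ite Fin.val] at *
    split_ifs <;> omega

theorem simpleReflection_involutive {n : ℕ} (v : Fin n) :
    Function.Involutive (simpleReflection n v) := by
  intro p
  have hv := v.isLt
  have hp := p.isLt
  apply Fin.ext
  rw [simpleReflection_val, simpleReflection_val]
  split_ifs <;> omega

theorem lt_simpleReflection_iff {n : ℕ} (v : Fin n) (p : Fin (2 * n)) :
    p < simpleReflection n v p ↔ p.val = v.val ∨ p.val = 2 * n - 2 - v.val := by
  have hv := v.isLt
  have hp := p.isLt
  rw [Fin.lt_def, simpleReflection_val]
  split_ifs <;> omega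

/-- The transpositions involved are adjacent, so the only pairs whose order is reversed are those
being swapped. -/
theorem eq_simpleReflection_of_flip {n : ℕ} (v : Fin n) {p q : Fin (2 * n)} (h : q < p)
    (h' : simpleReflection n v p < simpleReflection n v q) : p = simpleReflection n v q := by
  have hv := v.isLt
  have hp := p.isLt
  have hq := q.isLt
  rw [Fin.lt_def, simpleReflection_val, simpleReflection_val] at h'
  rw [Fin.lt_def] at h
  apply Fin.ext
  rw [simpleReflection_val]
  split_ifs at h' ⊢ <;> omega

/-! ## Counting inversions of type `C_n` -/

/-- The weight of a pair of positions in the inversion count: mirror pairs count twice. -/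
def pairWeight {n : ℕ} (p q : Fin (2 * n)) : ℕ := if q = p.rev then 2 else 1

theorem pairWeight_simpleReflection {n : ℕ} (v : Fin n) (p q : Fin (2 * n)) :
    pairWeight (simpleReflection n v p) (simpleReflection n v q) = pairWeight p q := by
  unfold pairWeight
  simp only [← simpleReflection_rev, (simpleReflection n v).injective.eq_iff]

/-- Twice the number of inversions of type `C_n` of a permutation commuting with `k ↦ k̄`. -/
def inversions {n : ℕ} (w : Equiv.Perm (Fin (2 * n))) : ℕ :=
  ∑ p, ∑ q, if p < q ∧ w q < w p then pairWeight p q else 0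

/-- This explains the weights: two mirror crossings count 1 each, a single central crossing counts
2, so every layer has the same total. -/
theorem sum_pairWeight_simpleReflection {n : ℕ} (v : Fin n) :
    ∑ q, (if q < simpleReflection n v q then pairWeight (simpleReflection n v q) q else 0) = 2 := by
  have hv := v.isLt
  simp only [lt_simpleReflection_iff]
  rw [← Finset.sum_filter]
  by_cases h : v.val + 1 = n
  · have : Finset.univ.filter (fun q : Fin (2 * n) => q.val = v.val ∨ q.val = 2 * n - 2 - v.val)
        = {⟨v.val, by omega⟩} := by
      ext q; simp [Fin.ext_iff]; omega
    rw [this, Finset.sum_singleton, pairWeight, if_pos]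
    apply Fin.ext
    rw [Fin.val_rev, simpleReflection_val]
    simp
    omega
  · have : Finset.univ.filter (fun q : Fin (2 * n) => q.val = v.val ∨ q.val = 2 * n - 2 - v.val)
        = {⟨v.val, by omega⟩, ⟨2 * n - 2 - v.val, by omega⟩} := by
      ext q; simp [Fin.ext_iff]
    rw [this, Finset.sum_pair (by simp [Fin.ext_iff]; omega), pairWeight, if_neg, pairWeight,
      if_neg]
    · rw [Fin.ext_iff, Fin.val_rev, simpleReflection_val]
      split_ifs <;> simp at * <;> omega
    · rw [Fin.ext_iff, Fin.val_rev, simpleReflection_val]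
      split_ifs <;> simp at * <;> omega

/-- After reindexing by the reflection, an inversion of the product is either an old inversion or
one of the swapped pairs whose values were still in increasing order. -/
theorem inversions_mul_le {n : ℕ} (w : Equiv.Perm (Fin (2 * n))) (v : Fin n) :
    inversions (w * simpleReflection n v) ≤ inversions w +
      ∑ q, if q < simpleReflection n v q ∧ w q < w (simpleReflection n v q) then
        pairWeight (simpleReflection n v q) q else 0 := by
  set s := simpleReflection n v with hs
  have h1 : inversions (w * s) =
      ∑ p, ∑ q, if s p < s q ∧ w q < w p then pairWeight p q else 0 := by
    unfold inversions
    rw [← Equiv.sum_comp s]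
    refine Finset.sum_congr rfl fun p _ => ?_
    rw [← Equiv.sum_comp s]
    refine Finset.sum_congr rfl fun q _ => ?_
    simp only [Equiv.Perm.mul_apply, hs, simpleReflection_involutive v _,
      pairWeight_simpleReflection]
  have h2 : ∑ q, (if q < s q ∧ w q < w (s q) then pairWeight (s q) q else 0) =
      ∑ p, ∑ q, if p = s q ∧ q < s q ∧ w q < w (s q) then pairWeight p q else 0 := by
    rw [Finset.sum_comm]
    refine Finset.sum_congr rfl fun q _ => ?_
    rw [Finset.sum_eq_single (s q)]
    · simp
    · intro p _ hp; simp [hp]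
    · simp
  rw [h1, h2, inversions, ← Finset.sum_add_distrib]
  refine Finset.sum_le_sum fun p _ => ?_
  rw [← Finset.sum_add_distrib]
  refine Finset.sum_le_sum fun q _ => ?_
  by_cases h : s p < s q ∧ w q < w p
  · rw [if_pos h]
    rcases lt_trichotomy p q with hpq | rfl | hpq
    · simp [hpq, h.2]
    · exact absurd h.1 (lt_irrefl _)
    · have := eq_simpleReflection_of_flip v hpq h.1
      rw [if_pos (c := p = s q ∧ _) ⟨this, by rw [hs, ← this]; exact hpq, by
        rw [hs, ← this]; exact h.2⟩]
      simp
  · simp [h]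

theorem inversions_mul_le_add_two {n : ℕ} (w : Equiv.Perm (Fin (2 * n))) (v : Fin n) :
    inversions (w * simpleReflection n v) ≤ inversions w + 2 := by
  refine (inversions_mul_le w v).trans (Nat.add_le_add_left
    (le_of_le_of_eq ?_ (sum_pairWeight_simpleReflection v)) _)
  refine Finset.sum_le_sum fun q _ => ?_
  split_ifs <;> simp_all

theorem inversions_mul_lt {n : ℕ} (w : Equiv.Perm (Fin (2 * n))) (v : Fin n) (p : Fin (2 * n))
    (hp : p < simpleReflection n v p) (hw : ¬ w p < w (simpleReflection n v p)) :
    inversions (w * simpleReflection n v) < inversions w + 2 := by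
  refine (inversions_mul_le w v).trans_lt (Nat.add_lt_add_left
    (lt_of_lt_of_eq ?_ (sum_pairWeight_simpleReflection v)) _)
  refine Finset.sum_lt_sum (fun q _ => ?_) ⟨p, Finset.mem_univ _, ?_⟩
  · split_ifs <;> simp_all
  · rw [if_neg (by tauto), if_pos hp]
    unfold pairWeight; split_ifs <;> simp

theorem inversions_one {n : ℕ} : inversions (1 : Equiv.Perm (Fin (2 * n))) = 0 := by
  unfold inversions
  refine Finset.sum_eq_zero fun p _ => Finset.sum_eq_zero fun q _ => if_neg ?_
  rintro ⟨h, h'⟩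
  exact lt_asymm h h'

theorem inversions_revPerm {n : ℕ} :
    inversions (Fin.revPerm : Equiv.Perm (Fin (2 * n))) = 2 * n ^ 2 := by
  -- All `n * (2 * n - 1)` pairs are inverted, and the `n` mirror pairs count once more, giving `2 *
  -- n ^ 2`.
  have h1 : ∀ p q : Fin (2 * n), (if p < q ∧ Fin.revPerm q < Fin.revPerm p then pairWeight p q
      else 0) = (if p < q then 1 else 0) + (if q = p.rev then if p < q then 1 else 0 else 0) := by
    intro p q
    simp only [Fin.revPerm_apply, Fin.rev_lt_rev, and_self, pairWeight]
    split_ifs <;> simp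
  unfold inversions
  simp only [h1, Finset.sum_add_distrib, Finset.sum_ite_eq', Finset.mem_univ, if_true]
  have h2 : ∀ p : Fin (2 * n), ∑ q, (if p < q then 1 else 0) = 2 * n - 1 - p.val := by
    intro p
    rw [Finset.sum_boole, Finset.filter_lt_eq_Ioi, Fin.card_Ioi]
    simp
  have h3 : ∀ p : Fin (2 * n), (if p < p.rev then 1 else 0) = if p.val < n then 1 else 0 := by
    intro p
    congr 1
    rw [Fin.lt_def, Fin.val_rev, eq_iff_iff]; omega
  simp only [h2, h3]
  rw [Fin.sum_univ_eq_sum_range (fun p => 2 * n - 1 - p), Finset.sum_range_reflect (fun p => p),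
    Fin.sum_univ_eq_sum_range (fun p => if p < n then 1 else 0), Finset.sum_boole]
  have h4 : (Finset.range (2 * n)).filter (· < n) = Finset.range n := by
    ext x; simp; omega
  rw [h4, Finset.card_range]
  have h5 := Finset.sum_range_id_mul_two (2 * n)
  rcases n with _ | m
  · simp
  · simp only [Nat.cast_id]
    have : 2 * (m + 1) - 1 = 2 * m + 1 := by omega
    rw [this] at h5
    nlinarith

/-! ## Wires at a node -/

theorem prefixProd_succ {n : ℕ} (i : Fin (n ^ 2) → Fin n) (j : Fin (n ^ 2)) :
    prefixProd i (j.val + 1) = prefixProd i j.val * simpleReflection n (i j) := by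
  unfold prefixProd
  rw [List.take_succ_eq_append_getElem (by simp)]
  simp

theorem prefixProd_zero {n : ℕ} (i : Fin (n ^ 2) → Fin n) : prefixProd i 0 = 1 := by
  simp [prefixProd]

theorem prefixProd_rev {n : ℕ} (i : Fin (n ^ 2) → Fin n) (h : ℕ) (p : Fin (2 * n)) :
    prefixProd i h p.rev = (prefixProd i h p).rev := by
  unfold prefixProd
  generalize (List.ofFn i).take h = l
  induction l generalizing p with
  | nil => rfl
  | cons v l ih => simp [Equiv.Perm.mul_apply, ih, simpleReflection_rev]

theorem IsReducedWord.prefixProd_eq {n : ℕ} {i : Fin (n ^ 2) → Fin n} (hi : IsReducedWord i) :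
    prefixProd i (n ^ 2) = Fin.revPerm := by
  unfold prefixProd
  rw [List.take_of_length_le (by simp)]
  exact hi

theorem inversions_prefixProd_le {n : ℕ} (i : Fin (n ^ 2) → Fin n) (g h : ℕ) (hh : g + h ≤ n ^ 2) :
    inversions (prefixProd i (g + h)) ≤ inversions (prefixProd i g) + 2 * h := by
  induction h with
  | zero => simp
  | succ h ih =>
    have := inversions_mul_le_add_two (prefixProd i (g + h)) (i ⟨g + h, by omega⟩)
    rw [← prefixProd_succ i ⟨g + h, by omega⟩] at this
    have := ih (by omega)
    simp only [← Nat.add_assoc] at *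
    omega

/-- In the diagram of a reduced word, the wire that comes to a node from the upper left has the
smaller label. -/
theorem IsReducedWord.prefixProd_lt {n : ℕ} {i : Fin (n ^ 2) → Fin n} (hi : IsReducedWord i)
    (j : Fin (n ^ 2)) (p : Fin (2 * n)) (hp : p < simpleReflection n (i j) p) :
    prefixProd i j.val p < prefixProd i j.val (simpleReflection n (i j) p) := by
  -- Each of the `n ^ 2` layers adds at most 2 and the total is `2 * n ^ 2`, so a layer that adds
  -- less cannot be compensated.
  by_contra hw
  have h1 := inversions_mul_lt _ _ p hp hw
  rw [← prefixProd_succ] at h1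
  have hj := j.isLt
  have h0 := inversions_prefixProd_le i 0 j.val (by omega)
  have h2 := inversions_prefixProd_le i (j.val + 1) (n ^ 2 - (j.val + 1)) (by omega)
  rw [Nat.add_sub_cancel' (by omega), hi.prefixProd_eq, inversions_revPerm] at h2
  rw [prefixProd_zero, inversions_one, Nat.zero_add] at h0
  omega

theorem wire_succ {n : ℕ} (i : Fin (n ^ 2) → Fin n) (j : Fin (n ^ 2)) (p : Fin (2 * n)) :
    wire i (j.succ, p) = wire i (j.castSucc, simpleReflection n (i j) p) := by
  simp [wire, prefixProd_succ]

theorem wire_rev {n : ℕ} (i : Fin (n ^ 2) → Fin n) (h : Fin (n ^ 2 + 1)) (p : Fin (2 * n)) :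
    wire i (h, p.rev) = (wire i (h, p)).rev :=
  prefixProd_rev i _ p

theorem IsReducedWord.wire_last {n : ℕ} {i : Fin (n ^ 2) → Fin n} (hi : IsReducedWord i)
    (p : Fin (2 * n)) : wire i (Fin.last (n ^ 2), p) = p.rev := by
  simp [wire, hi.prefixProd_eq]

theorem strand_ext_of_wire {n : ℕ} {i : Fin (n ^ 2) → Fin n} {x y : Strand n} (h : x.1 = y.1)
    (hw : wire i x = wire i y) : x = y := by
  rcases x with ⟨l, p⟩
  rcases y with ⟨l', q⟩
  obtain rfl : l = l' := h
  exact congrArg _ ((prefixProd i l.val).injective hw)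

theorem IsLowerEnd.eq {n : ℕ} {i : Fin (n ^ 2) → Fin n} {r : ℕ} {x y : Strand n}
    (hx : IsLowerEnd i r x) (hy : IsLowerEnd i r y) : x = y :=
  strand_ext_of_wire (i := i) (hx.1.trans hy.1.symm) (Fin.ext (by have := hx.2; have := hy.2; omega))

theorem isUp_rev {n : ℕ} (r : Fin (2 * n)) : IsUp n r.rev ↔ ¬ IsUp n r := by
  have := r.isLt
  simp only [IsUp, Fin.val_rev]
  omega

/-! ## Nodes -/

namespace Node

variable {n : ℕ} {i : Fin (n ^ 2) → Fin n}

theorem left_lt_right (d : Node i) : d.left < d.right := d.2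

theorem simpleReflection_left (d : Node i) :
    simpleReflection n (i d.layer) d.left = d.right := rfl

theorem simpleReflection_right (d : Node i) :
    simpleReflection n (i d.layer) d.right = d.left :=
  simpleReflection_involutive _ _

theorem wire_lowerLeft (d : Node i) :
    wire i (d.layer.succ, d.left) = wire i (d.layer.castSucc, d.right) :=
  wire_succ i d.layer d.left

theorem wire_lowerRight (d : Node i) :
    wire i (d.layer.succ, d.right) = wire i (d.layer.castSucc, d.left) := by
  rw [wire_succ, simpleReflection_right]

theorem wire_upperLeft_lt (hi : IsReducedWord i) (d : Node i) :
    wire i (d.layer.castSucc, d.left) < wire i (d.layer.castSucc, d.right) :=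
  hi.prefixProd_lt d.layer d.left d.2

theorem ext_left {d e : Node i} (h : d.layer = e.layer) (h' : d.left = e.left) : d = e :=
  Subtype.ext (Prod.ext h h')

theorem simpleReflection_ne {d : Node i} {p : Fin (2 * n)} (h : p = d.left ∨ p = d.right) :
    simpleReflection n (i d.layer) p ≠ p := by
  rcases h with rfl | rfl
  · exact d.left_lt_right.ne'
  · rw [simpleReflection_right]; exact d.left_lt_right.ne

theorem eq_of_mem {d e : Node i} (h : d.layer = e.layer) {p : Fin (2 * n)}
    (hd : p = d.left ∨ p = d.right) (he : p = e.left ∨ p = e.right) : d = e := by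
  have h1 := d.left_lt_right
  have h2 := e.left_lt_right
  have h3 := d.simpleReflection_right
  have h4 := e.simpleReflection_right
  have h5 := d.simpleReflection_left
  have h6 := e.simpleReflection_left
  rw [← h] at h4 h6
  refine ext_left h ?_
  rcases hd with rfl | rfl <;> rcases he with he | he
  · exact he
  · rw [he] at h1 h5
    rw [h5] at h4
    exact absurd (h4 ▸ h1) (lt_asymm h2)
  · rw [← he] at h6 h2
    rw [h3] at h6
    exact absurd (h6 ▸ h2) (lt_asymm h1)
  · rw [← he, h3] at h4
    exact h4

theorem exists_of_moved (j : Fin (n ^ 2)) (p : Fin (2 * n)) (h : simpleReflection n (i j) p ≠ p) :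
    ∃ d : Node i, d.layer = j ∧ (p = d.left ∨ p = d.right) := by
  rcases lt_or_gt_of_ne h with h | h
  · refine ⟨⟨(j, simpleReflection n (i j) p), ?_⟩, rfl, Or.inr ?_⟩
    · simpa [simpleReflection_involutive _ _] using h
    · exact (simpleReflection_involutive _ _).symm
  · exact ⟨⟨(j, p), h⟩, rfl, Or.inl rfl⟩

/-- The mirror image of a node. -/
def mirror (d : Node i) : Node i :=
  ⟨(d.layer, d.right.rev), by
    rw [simpleReflection_rev, simpleReflection_right]
    exact Fin.rev_lt_rev.2 d.left_lt_right⟩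

theorem layer_mirror (d : Node i) : d.mirror.layer = d.layer := rfl

theorem left_mirror (d : Node i) : d.mirror.left = d.right.rev := rfl

theorem right_mirror (d : Node i) : d.mirror.right = d.left.rev := by
  change simpleReflection n (i d.layer) d.right.rev = _
  rw [simpleReflection_rev, simpleReflection_right]

theorem mirror_mirror (d : Node i) : d.mirror.mirror = d :=
  ext_left rfl (by rw [left_mirror, right_mirror, Fin.rev_rev])

theorem left_val (d : Node i) :
    d.left.val = (i d.layer).val ∨ d.left.val = 2 * n - 2 - (i d.layer).val :=
  (lt_simpleReflection_iff _ _).1 d.2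

theorem right_val (d : Node i) : d.right.val = d.left.val + 1 := by
  have h := d.left_val
  have hv := (i d.layer).isLt
  have := d.left.isLt
  rw [← simpleReflection_left, simpleReflection_val]
  split_ifs <;> omega

theorem eq_or_eq_mirror {d e : Node i} (h : d.layer = e.layer) : d = e ∨ d = e.mirror := by
  have hd := d.left_val
  have he := e.left_val
  have her := e.right_val
  have hv := (i e.layer).isLt
  rw [h] at hd
  by_cases hde : d.left.val = e.left.val
  · exact Or.inl (ext_left h (Fin.ext hde))
  · refine Or.inr (ext_left h (Fin.ext ?_))
    rw [left_mirror, Fin.val_rev]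
    omega

end Node

/-! ## Reflection in the wall -/

/-- The reflection of a strand in the wall. -/
def reflect {n : ℕ} (x : Strand n) : Strand n := (x.1, x.2.rev)

theorem reflect_reflect {n : ℕ} (x : Strand n) : reflect (reflect x) = x := by
  simp [reflect]

theorem wire_reflect {n : ℕ} (i : Fin (n ^ 2) → Fin n) (x : Strand n) :
    wire i (reflect x) = (wire i x).rev :=
  wire_rev i x.1 x.2

theorem mirror_eq {n : ℕ} (P : List (Strand n)) : mirror P = (P.map reflect).reverse := rfl

theorem mirror_mirror {n : ℕ} (P : List (Strand n)) : mirror (mirror P) = P := by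
  simp [mirror_eq, List.map_reverse, Function.comp_def, reflect_reflect]

theorem mirror_append {n : ℕ} (P Q : List (Strand n)) :
    mirror (P ++ Q) = mirror Q ++ mirror P := by
  simp [mirror_eq]

theorem length_mirror {n : ℕ} (P : List (Strand n)) : (mirror P).length = P.length := by
  simp [mirror_eq]

/-- The involution on labels swaps the upward and downward wires when `k = n`, so incoming strands
become outgoing ones; this is why the mirror must also reverse the path. -/
theorem enters_reflect {n : ℕ} (i : Fin (n ^ 2) → Fin n) (j : Fin (n ^ 2)) (x : Strand n) :
    Enters i n j (reflect x) ↔ Leaves i n j x := by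
  rw [Enters, Leaves, wire_reflect, isUp_rev, not_not]
  exact or_comm

theorem leaves_reflect {n : ℕ} (i : Fin (n ^ 2) → Fin n) (j : Fin (n ^ 2)) (x : Strand n) :
    Leaves i n j (reflect x) ↔ Enters i n j x := by
  rw [← enters_reflect, reflect_reflect]

theorem reflect_mem_node {n : ℕ} {i : Fin (n ^ 2) → Fin n} (d : Node i) (x : Strand n) :
    ((reflect x).2 = d.mirror.left ∨ (reflect x).2 = d.mirror.right) ↔
      (x.2 = d.left ∨ x.2 = d.right) := by
  rw [Node.left_mirror, Node.right_mirror, reflect, Fin.rev_inj, Fin.rev_inj, or_comm]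

theorem passesNode_reflect {n : ℕ} {i : Fin (n ^ 2) → Fin n} (d : Node i) (x y : Strand n) :
    PassesNode i n d.mirror (reflect y) (reflect x) ↔ PassesNode i n d x y := by
  rw [PassesNode, PassesNode, Node.layer_mirror, enters_reflect, leaves_reflect, reflect_mem_node,
    reflect_mem_node]
  tauto

theorem isForbidden_reflect {n : ℕ} {i : Fin (n ^ 2) → Fin n} (d : Node i) (x y : Strand n) :
    IsForbidden i n d.mirror (reflect y) (reflect x) ↔ IsForbidden i n d x y := by
  rw [IsForbidden, IsForbidden, Node.layer_mirror, Node.left_mirror, Node.right_mirror, wire_rev,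
    wire_rev, isUp_rev, isUp_rev, reflect, reflect, Fin.rev_inj, Fin.rev_inj]
  tauto

theorem IsStep.reflect {n : ℕ} {i : Fin (n ^ 2) → Fin n} {x y : Strand n} (h : IsStep i n x y) :
    IsStep i n (reflect y) (reflect x) := by
  rcases h with ⟨j, hx, hy, hxy, hs⟩ | ⟨d, hd, hf⟩
  · refine Or.inl ⟨j, (enters_reflect _ _ _).2 hy, (leaves_reflect _ _ _).2 hx, ?_, ?_⟩
    · simp [SympString.reflect, hxy]
    · simp only [SympString.reflect]
      rw [simpleReflection_rev, ← hxy, hs]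
  · exact Or.inr ⟨d.mirror, (passesNode_reflect _ _ _).2 hd, by rwa [isForbidden_reflect]⟩

theorem isChain_mirror {n : ℕ} {i : Fin (n ^ 2) → Fin n} {P : List (Strand n)}
    (h : P.IsChain (IsStep i n)) : (mirror P).IsChain (IsStep i n) := by
  rw [mirror_eq, List.isChain_reverse, List.isChain_map]
  exact h.imp fun _ _ => IsStep.reflect

/-! ## String functions as sums along paths -/

/-- The sum of `f` over all pairs of consecutive entries of a list. -/
def pathSum {α : Type*} (f : α → α → ℝ) : List α → ℝ
  | [] => 0
  | [_] => 0
  | x :: y :: l => f x y + pathSum f (y :: l)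

theorem pathSum_eq_sum {α : Type*} (f : α → α → ℝ) (P : List α) :
    pathSum f P = ∑ b : Fin (P.length - 1), f (P[b.val]'(by omega)) (P[b.val + 1]'(by omega)) := by
  induction P with
  | nil => rfl
  | cons x P ih =>
    cases P with
    | nil => rfl
    | cons y l =>
      rw [pathSum, ih]
      exact (Fin.sum_univ_succ (n := l.length) fun b : Fin (l.length + 1) =>
        f ((x :: y :: l)[b.val]'(by simp)) ((x :: y :: l)[b.val + 1]'(by simp; omega))).symm

theorem pathSum_append {α : Type*} (f : α → α → ℝ) (A B : List α) (x y : α) :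
    pathSum f (A ++ [x] ++ y :: B) = pathSum f (A ++ [x]) + f x y + pathSum f (y :: B) := by
  induction A with
  | nil => simp [pathSum]
  | cons z A ih =>
    cases A with
    | nil => simp [pathSum, add_assoc]
    | cons u A => simpa [pathSum, add_assoc] using ih

theorem pathSum_concat {α : Type*} (f : α → α → ℝ) (A : List α) (x y : α) :
    pathSum f (A ++ [x] ++ [y]) = pathSum f (A ++ [x]) + f x y := by
  rw [pathSum_append]
  simp [pathSum]

theorem pathSum_mirror {n : ℕ} {f : Strand n → Strand n → ℝ}
    (hf : ∀ x y, f (reflect y) (reflect x) = f x y) (P : List (Strand n)) :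
    pathSum f (mirror P) = pathSum f P := by
  induction P with
  | nil => rfl
  | cons x P ih =>
    cases P with
    | nil => rfl
    | cons y l =>
      rw [pathSum, ← ih, mirror_eq, mirror_eq]
      simp only [List.map_cons, List.reverse_cons]
      rw [pathSum_concat, hf, add_comm]

/-- The sign of a change from the wire `r` to the wire `s`. -/
def crossSign {m : ℕ} (r s : Fin m) : ℝ := if r < s then 1 else if s < r then -1 else 0

theorem crossSign_rev {m : ℕ} (r s : Fin m) : crossSign s.rev r.rev = crossSign r s := by
  simp [crossSign, Fin.rev_lt_rev]

theorem crossSign_of_lt {m : ℕ} {r s : Fin m} (h : r < s) : crossSign r s = 1 := if_pos h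

theorem crossSign_of_gt {m : ℕ} {r s : Fin m} (h : s < r) : crossSign r s = -1 := by
  rw [crossSign, if_neg (lt_asymm h), if_pos h]

theorem crossSign_self {m : ℕ} (r : Fin m) : crossSign r r = 0 := by
  simp [crossSign]

/-- The path `P` passes through each node at most once. -/
def NodeOnce {n : ℕ} (i : Fin (n ^ 2) → Fin n) (k : ℕ) (P : List (Strand n)) : Prop :=
  ∀ (d : Node i) (b c : ℕ), PassesAt i k P d b → PassesAt i k P d c → b = c

/-- Passing the node only once makes the existential conditions in `coeff` refer to a single step.
This lets string functions be computed as sums along paths. -/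
theorem coeff_of_passes {n : ℕ} {i : Fin (n ^ 2) → Fin n} {k : ℕ} {P : List (Strand n)}
    (hP : NodeOnce i k P) {d : Node i} {b : ℕ} (hb : b + 1 < P.length)
    (hd : PassesNode i k d P[b] P[b + 1]) :
    coeff i k P d = crossSign (wire i P[b]) (wire i P[b + 1]) := by
  have key : ∀ r s, Travels i k P d r s ↔ wire i P[b] = r ∧ wire i P[b + 1] = s := by
    intro r s
    constructor
    · rintro ⟨c, hc, hd', hr, hs⟩
      obtain rfl := hP d b c ⟨hb, hd⟩ ⟨hc, hd'⟩
      exact ⟨hr, hs⟩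
    · rintro ⟨hr, hs⟩
      exact ⟨b, hb, hd, hr, hs⟩
  have key1 : (∃ r s, r < s ∧ Travels i k P d r s) ↔ wire i P[b] < wire i P[b + 1] := by
    simp [key]
  have key2 : (∃ r s, s < r ∧ Travels i k P d r s) ↔ wire i P[b + 1] < wire i P[b] := by
    simp [key]
  rw [coeff, crossSign]
  simp only [key1, key2]

theorem coeff_of_not_passes {n : ℕ} {i : Fin (n ^ 2) → Fin n} {k : ℕ} {P : List (Strand n)}
    {d : Node i} (hd : ∀ b, ¬ PassesAt i k P d b) : coeff i k P d = 0 := by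
  have key : ∀ r s, ¬ Travels i k P d r s := by
    rintro r s ⟨b, hb, h, -⟩
    exact hd b ⟨hb, h⟩
  rw [coeff, if_neg, if_neg]
  · rintro ⟨r, s, -, h⟩; exact key r s h
  · rintro ⟨r, s, -, h⟩; exact key r s h

open Classical in
/-- The contribution of two consecutive strands of a path to its string function. -/
noncomputable def stepWeight {n : ℕ} (i : Fin (n ^ 2) → Fin n) (k : ℕ) (t : Node i → ℝ)
    (x y : Strand n) : ℝ :=
  ∑ d : Node i, if PassesNode i k d x y then crossSign (wire i x) (wire i y) * t d else 0

theorem stringFunctionA_eq_pathSum {n : ℕ} {i : Fin (n ^ 2) → Fin n} {k : ℕ}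
    {P : List (Strand n)} (hP : NodeOnce i k P) (t : Node i → ℝ) :
    stringFunctionA i k P t = pathSum (stepWeight i k t) P := by
  classical
  rw [pathSum_eq_sum, stringFunctionA]
  unfold stepWeight
  rw [Finset.sum_comm]
  refine Finset.sum_congr rfl fun d _ => ?_
  by_cases h : ∃ b, PassesAt i k P d b
  · obtain ⟨b, hb, hd⟩ := h
    rw [coeff_of_passes hP hb hd, Finset.sum_eq_single ⟨b, by omega⟩, if_pos hd]
    · intro c _ hc
      refine if_neg fun h => hc (Fin.ext ?_)
      exact hP d _ _ ⟨by omega, h⟩ ⟨hb, hd⟩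
    · simp
  · rw [coeff_of_not_passes fun b hb => h ⟨b, hb⟩, zero_mul, Finset.sum_eq_zero]
    intro b _
    exact if_neg fun hd => h ⟨b, by omega, hd⟩

theorem PassesNode.unique {n : ℕ} {i : Fin (n ^ 2) → Fin n} {k : ℕ} {d e : Node i}
    {x y : Strand n} (hd : PassesNode i k d x y) (he : PassesNode i k e x y) : d = e := by
  refine Node.eq_of_mem ?_ hd.2.2.1 he.2.2.1
  rcases hd.1 with h | h <;> rcases he.1 with h' | h'
  · exact Fin.succ_injective _ (h.2.symm.trans h'.2)
  · exact absurd h.1 h'.1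
  · exact absurd h'.1 h.1
  · exact Fin.castSucc_injective _ (h.2.symm.trans h'.2)

theorem stepWeight_of_passes {n : ℕ} {i : Fin (n ^ 2) → Fin n} {k : ℕ} (t : Node i → ℝ)
    {d : Node i} {x y : Strand n} (hd : PassesNode i k d x y) :
    stepWeight i k t x y = crossSign (wire i x) (wire i y) * t d := by
  rw [stepWeight, Finset.sum_eq_single d, if_pos hd]
  · exact fun e _ he => if_neg fun h => he (h.unique hd)
  · simp

theorem stepWeight_of_not_passes {n : ℕ} {i : Fin (n ^ 2) → Fin n} {k : ℕ} (t : Node i → ℝ)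
    {x y : Strand n} (h : ∀ d : Node i, ¬ PassesNode i k d x y) : stepWeight i k t x y = 0 :=
  Finset.sum_eq_zero fun d _ => if_neg (h d)

theorem stepWeight_reflect {n : ℕ} {i : Fin (n ^ 2) → Fin n} {t : Node i → ℝ}
    (ht : ∀ d : Node i, t d.mirror = t d) (x y : Strand n) :
    stepWeight i n t (reflect y) (reflect x) = stepWeight i n t x y := by
  by_cases h : ∃ d : Node i, PassesNode i n d x y
  · obtain ⟨d, hd⟩ := h
    rw [stepWeight_of_passes t hd, stepWeight_of_passes t ((passesNode_reflect _ _ _).2 hd), ht,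
      wire_reflect, wire_reflect, crossSign_rev]
  · rw [stepWeight_of_not_passes t fun d hd => h ⟨d, hd⟩, stepWeight_of_not_passes]
    intro d hd
    refine h ⟨d.mirror, (passesNode_reflect _ _ _).1 ?_⟩
    rwa [Node.mirror_mirror]

theorem unfoldCoords_mirror {n : ℕ} {i : Fin (n ^ 2) → Fin n} (a : Fin (n ^ 2) → ℝ) (d : Node i) :
    unfoldCoords i a d.mirror = unfoldCoords i a d := rfl

/-! ## Orientations at a node -/

namespace Node

variable {n : ℕ} {i : Fin (n ^ 2) → Fin n}

theorem enters_left (k : ℕ) (d : Node i) (l : Fin (n ^ 2 + 1)) :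
    Enters i k d.layer (l, d.left) ↔
      (l = d.layer.castSucc ∧ ¬ IsUp k (wire i (d.layer.castSucc, d.left))) ∨
      (l = d.layer.succ ∧ IsUp k (wire i (d.layer.castSucc, d.right))) := by
  rw [← wire_lowerLeft, Enters, or_comm]
  refine or_congr ?_ ?_ <;> (constructor <;> (rintro ⟨h, h'⟩; simp_all))

theorem enters_right (k : ℕ) (d : Node i) (l : Fin (n ^ 2 + 1)) :
    Enters i k d.layer (l, d.right) ↔
      (l = d.layer.castSucc ∧ ¬ IsUp k (wire i (d.layer.castSucc, d.right))) ∨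
      (l = d.layer.succ ∧ IsUp k (wire i (d.layer.castSucc, d.left))) := by
  rw [← wire_lowerRight, Enters, or_comm]
  refine or_congr ?_ ?_ <;> (constructor <;> (rintro ⟨h, h'⟩; simp_all))

theorem leaves_left (k : ℕ) (d : Node i) (l : Fin (n ^ 2 + 1)) :
    Leaves i k d.layer (l, d.left) ↔
      (l = d.layer.castSucc ∧ IsUp k (wire i (d.layer.castSucc, d.left))) ∨
      (l = d.layer.succ ∧ ¬ IsUp k (wire i (d.layer.castSucc, d.right))) := by
  rw [← wire_lowerLeft, Leaves]
  refine or_congr ?_ ?_ <;> (constructor <;> (rintro ⟨h, h'⟩; simp_all))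

theorem leaves_right (k : ℕ) (d : Node i) (l : Fin (n ^ 2 + 1)) :
    Leaves i k d.layer (l, d.right) ↔
      (l = d.layer.castSucc ∧ IsUp k (wire i (d.layer.castSucc, d.right))) ∨
      (l = d.layer.succ ∧ ¬ IsUp k (wire i (d.layer.castSucc, d.left))) := by
  rw [← wire_lowerRight, Leaves]
  refine or_congr ?_ ?_ <;> (constructor <;> (rintro ⟨h, h'⟩; simp_all))

/-- A node is central if it lies on the wall. -/
def IsCentral (d : Node i) : Prop := d.left.val < n ∧ n ≤ d.right.val

theorem IsCentral.mirror_eq {d : Node i} (hd : d.IsCentral) : d.mirror = d := by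
  have := d.right_val
  refine ext_left rfl (Fin.ext ?_)
  rw [left_mirror, Fin.val_rev]
  have := hd.1
  have := hd.2
  omega

theorem IsCentral.rev_left {d : Node i} (hd : d.IsCentral) : d.left.rev = d.right := by
  rw [← right_mirror, hd.mirror_eq]

theorem IsCentral.wire_right {d : Node i} (hd : d.IsCentral) :
    wire i (d.layer.castSucc, d.right) = (wire i (d.layer.castSucc, d.left)).rev := by
  rw [← hd.rev_left, wire_rev]

theorem IsCentral.isUp_left (hi : IsReducedWord i) {d : Node i} (hd : d.IsCentral) :
    IsUp n (wire i (d.layer.castSucc, d.left)) := by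
  have h := d.wire_upperLeft_lt hi
  rw [hd.wire_right, Fin.lt_def, Fin.val_rev] at h
  rw [IsUp]
  omega

theorem IsCentral.not_isUp_right (hi : IsReducedWord i) {d : Node i} (hd : d.IsCentral) :
    ¬ IsUp n (wire i (d.layer.castSucc, d.right)) := by
  rw [hd.wire_right, isUp_rev, not_not]
  exact hd.isUp_left hi

/-- The upward wire runs from lower right to upper left and the downward wire from upper right to
lower left. -/
theorem IsCentral.right_left_of_passes (hi : IsReducedWord i) {d : Node i} (hd : d.IsCentral)
    {x y : Strand n} (h : PassesNode i n d x y) : x.2 = d.right ∧ y.2 = d.left := by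
  obtain ⟨hx, hy, hx', hy'⟩ := h
  rcases x with ⟨l, p⟩
  rcases y with ⟨m, q⟩
  have h1 := hd.isUp_left hi
  have h2 := hd.not_isUp_right hi
  constructor
  · refine hx'.resolve_left ?_
    rintro rfl
    exact absurd ((enters_left n d l).1 hx) (by tauto)
  · refine hy'.resolve_right ?_
    rintro rfl
    exact absurd ((leaves_right n d m).1 hy) (by tauto)

end Node

/-! ### Crossing the wall -/

variable {n : ℕ} {i : Fin (n ^ 2) → Fin n}

/-- At the wall, a path in the `n`-th oriented diagram can only go from the right to the left. -/
theorem IsStep.left_of_left (hi : IsReducedWord i) {x y : Strand n} (h : IsStep i n x y)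
    (hx : x.2.val < n) : y.2.val < n := by
  rcases h with ⟨j, -, -, hxy, -⟩ | ⟨d, hd, -⟩
  · rwa [← hxy]
  · by_contra hy
    have hlr := d.right_val
    have hc : d.IsCentral := by
      rcases hd.2.2.1 with h | h <;> rcases hd.2.2.2 with h' | h' <;> rw [h] at hx <;>
        rw [h'] at hy <;> constructor <;> omega
    rw [(hc.right_left_of_passes hi hd).2] at hy
    exact hy hc.1

theorem IsStep.central_of_cross {x y : Strand n} (h : IsStep i n x y) (hx : n ≤ x.2.val)
    (hy : y.2.val < n) : ∃ d : Node i, d.IsCentral ∧ PassesNode i n d x y := by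
  rcases h with ⟨j, -, -, hxy, -⟩ | ⟨d, hd, -⟩
  · rw [hxy] at hx
    omega
  · refine ⟨d, ?_, hd⟩
    have hlr := d.right_val
    rcases hd.2.2.1 with h | h <;> rcases hd.2.2.2 with h' | h' <;> rw [h] at hx <;>
      rw [h'] at hy <;> constructor <;> omega

theorem IsLowerEnd.reflect {x : Strand n} (h : IsLowerEnd i n x) :
    IsLowerEnd i (n + 1) (reflect x) := by
  refine ⟨h.1, ?_⟩
  have := h.2
  rw [wire_reflect, Fin.val_rev]
  omega

theorem IsLowerEnd.reflect_succ {x : Strand n} (h : IsLowerEnd i (n + 1) x) :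
    IsLowerEnd i n (SympString.reflect x) := by
  refine ⟨h.1, ?_⟩
  have := h.2
  rw [wire_reflect, Fin.val_rev]
  omega

/-- The order of the wires is reversed at the bottom, which puts `L_n` just right of the wall. -/
theorem IsLowerEnd.right (hi : IsReducedWord i) {x : Strand n} (h : IsLowerEnd i n x) :
    n ≤ x.2.val := by
  rcases x with ⟨l, p⟩
  obtain rfl : l = _ := h.1
  have := h.2
  rw [hi.wire_last, Fin.val_rev] at this
  dsimp only
  omega

theorem IsLowerEnd.left (hi : IsReducedWord i) {x : Strand n} (h : IsLowerEnd i (n + 1) x) :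
    x.2.val < n := by
  rcases x with ⟨l, p⟩
  obtain rfl : l = _ := h.1
  have := h.2
  rw [hi.wire_last, Fin.val_rev] at this
  dsimp only
  omega

/-! ### Nodes of mirrored and concatenated paths -/

theorem passesAt_mirror {P : List (Strand n)} {d : Node i} {b : ℕ}
    (h : PassesAt i n (mirror P) d b) : PassesAt i n P d.mirror (P.length - 2 - b) := by
  obtain ⟨hb, hd⟩ := h
  rw [length_mirror] at hb
  refine ⟨by omega, ?_⟩
  have h1 : ∀ c (hc : c < (mirror P).length), (mirror P)[c] =
      reflect (P[P.length - 1 - c]'(by rw [length_mirror] at hc; omega)) := by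
    intro c hc
    simp [mirror_eq]
  rw [h1, h1] at hd
  rw [← passesNode_reflect, Node.mirror_mirror]
  have e1 : P.length - 2 - b + 1 = P.length - 1 - b := by omega
  have e2 : P.length - 1 - (b + 1) = P.length - 2 - b := by omega
  simp only [e1]
  simpa only [e2] using hd

theorem NodeOnce.mirror {P : List (Strand n)} (hP : NodeOnce i n P) : NodeOnce i n (mirror P) := by
  intro d b c hb hc
  have h1 := hb.1
  have h2 := hc.1
  rw [length_mirror] at h1 h2
  have := hP _ _ _ (passesAt_mirror hb) (passesAt_mirror hc)
  omega

theorem passesAt_append_left {k : ℕ} {P Q : List (Strand n)} {d : Node i} {b : ℕ}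
    (hb : b + 1 < P.length) : PassesAt i k (P ++ Q) d b ↔ PassesAt i k P d b := by
  have : b + 1 < (P ++ Q).length := by rw [List.length_append]; omega
  simp only [PassesAt, hb, this, exists_true_left]
  rw [List.getElem_append_left, List.getElem_append_left]

theorem passesAt_append_right {k : ℕ} {P Q : List (Strand n)} {d : Node i} {b : ℕ} :
    PassesAt i k (P ++ Q) d (P.length + b) ↔ PassesAt i k Q d b := by
  constructor
  · rintro ⟨h, hd⟩
    rw [List.length_append] at h
    refine ⟨by omega, ?_⟩
    rw [List.getElem_append_right (by omega), List.getElem_append_right (by omega)] at hd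
    convert hd using 2 <;> omega
  · rintro ⟨h, hd⟩
    refine ⟨by rw [List.length_append]; omega, ?_⟩
    rw [List.getElem_append_right (by omega), List.getElem_append_right (by omega)]
    convert hd using 2 <;> omega

theorem NodeOnce.append_left {k : ℕ} {P Q : List (Strand n)} (h : NodeOnce i k (P ++ Q)) :
    NodeOnce i k P := by
  intro d b c hb hc
  exact h d b c ((passesAt_append_left hb.1).2 hb) ((passesAt_append_left hc.1).2 hc)

theorem NodeOnce.append_right {k : ℕ} {P Q : List (Strand n)} (h : NodeOnce i k (P ++ Q)) :
    NodeOnce i k Q := by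
  intro d b c hb hc
  have := h d _ _ (passesAt_append_right.2 hb) (passesAt_append_right.2 hc)
  omega

/-! ## Half paths -/

/-- The part of a path from `L_n` to the central node `d`; it stays in the right half of the
diagram. -/
structure IsHalfPath (i : Fin (n ^ 2) → Fin n) (d : Node i) (A : List (Strand n)) : Prop where
  starts : ∃ x, A.head? = some x ∧ IsLowerEnd i n x
  ends : ∃ x, A.getLast? = some x ∧ Enters i n d.layer x ∧ x.2 = d.right
  isChain : A.IsChain (IsStep i n)
  node_once : NodeOnce i n A
  right : ∀ x ∈ A, n ≤ x.2.val

theorem IsHalfPath.left_of_passesAt (hi : IsReducedWord i) {d e : Node i} {A : List (Strand n)}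
    (hA : IsHalfPath i d A) {b : ℕ} (h : PassesAt i n A e b) : n ≤ e.left.val := by
  obtain ⟨hb, h⟩ := h
  by_contra hl
  have h1 := hA.right _ (List.getElem_mem (show b < A.length by omega))
  have h2 := hA.right _ (List.getElem_mem hb)
  have hc : e.IsCentral := by
    have := e.right_val
    rcases h.2.2.1 with h | h <;> rw [h] at h1
    · omega
    · exact ⟨by omega, h1⟩
  rw [(hc.right_left_of_passes hi h).2] at h2
  exact hl h2

theorem IsHalfPath.right_of_passesAt_mirror (hi : IsReducedWord i) {d e : Node i}
    {A : List (Strand n)} (hA : IsHalfPath i d A) {b : ℕ} (h : PassesAt i n (mirror A) e b) :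
    e.right.val < n := by
  have := hA.left_of_passesAt hi (passesAt_mirror h)
  rw [Node.left_mirror, Fin.val_rev] at this
  omega

/-- Any two half paths ending at the same central node can be glued: the two wires there have
opposite orientations, so no fragment is forbidden. -/
theorem IsHalfPath.isStep (hi : IsReducedWord i) {d : Node i} (hd : d.IsCentral) {x y : Strand n}
    (hx : Enters i n d.layer x ∧ x.2 = d.right) (hy : Enters i n d.layer y ∧ y.2 = d.right) :
    PassesNode i n d x (reflect y) ∧ IsStep i n x (reflect y) := by
  have h : PassesNode i n d x (reflect y) :=
    ⟨hx.1, (leaves_reflect _ _ _).2 hy.1, Or.inr hx.2, Or.inl (by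
      rw [reflect, hy.2, ← hd.rev_left, Fin.rev_rev])⟩
  refine ⟨h, Or.inr ⟨d, h, fun hf => ?_⟩⟩
  exact hd.not_isUp_right hi (hf.1.1 (hd.isUp_left hi))

theorem IsHalfPath.append_mirror (hi : IsReducedWord i) {d : Node i} (hd : d.IsCentral)
    {A B : List (Strand n)} (hA : IsHalfPath i d A) (hB : IsHalfPath i d B) :
    A ++ mirror B ∈ rigorousPaths i n := by
  obtain ⟨x, hx, hx'⟩ := hA.ends
  obtain ⟨y, hy, hy'⟩ := hB.ends
  obtain ⟨hp, hs⟩ := IsHalfPath.isStep hi hd hx' hy'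
  have hm : (mirror B).head? = some (reflect y) := by
    rw [mirror_eq, List.head?_reverse, List.getLast?_map, hy, Option.map_some]
  refine ⟨?_, ?_, ?_, ?_⟩
  · obtain ⟨z, hz, hz'⟩ := hA.starts
    exact ⟨z, by simp [hz], hz'⟩
  · obtain ⟨z, hz, hz'⟩ := hB.starts
    refine ⟨reflect z, ?_, hz'.reflect⟩
    simp [mirror_eq, hz]
  · refine List.isChain_append.2 ⟨hA.isChain, isChain_mirror hB.isChain, ?_⟩
    rw [hx, hm]
    simpa using hs
  -- No node is repeated, because the nodes of `A` lie right of the wall, those of `mirror B` left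
  -- of it, and only the junction is central.
  · have key : ∀ (e : Node i) (b : ℕ), PassesAt i n (A ++ mirror B) e b →
        (b + 1 < A.length ∧ PassesAt i n A e b ∧ n ≤ e.left.val) ∨
        (b + 1 = A.length ∧ e.IsCentral) ∨
        (∃ c, b = A.length + c ∧ PassesAt i n (mirror B) e c ∧ e.right.val < n) := by
      intro e b h
      rcases lt_trichotomy (b + 1) A.length with hb | hb | hb
      · have h' := (passesAt_append_left hb).1 h
        exact Or.inl ⟨hb, h', hA.left_of_passesAt hi h'⟩
      · refine Or.inr (Or.inl ⟨hb, ?_⟩)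
        obtain ⟨hlt, h⟩ := h
        rw [List.getElem_append_left (by omega), List.getElem_append_right (by omega)] at h
        have h1 : A[b] = x := by
          rw [List.getLast?_eq_getElem?, ← hb, Nat.add_sub_cancel,
            List.getElem?_eq_getElem (by omega)] at hx
          exact Option.some.inj hx
        have h2 : (mirror B)[b + 1 - A.length]'(by
            rw [List.length_append] at hlt; omega) = reflect y := by
          rw [List.head?_eq_getElem?, List.getElem?_eq_getElem (by
            rw [List.length_append] at hlt; omega)] at hm
          simp only [hb, Nat.sub_self]
          exact Option.some.inj hm
        rw [h1, h2] at h
        rwa [h.unique hp]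
      · obtain ⟨c, rfl⟩ := Nat.exists_eq_add_of_le (show A.length ≤ b by omega)
        have h' := passesAt_append_right.1 h
        exact Or.inr (Or.inr ⟨c, rfl, h', hB.right_of_passesAt_mirror hi h'⟩)
    intro e b c hb hc
    have hlr := e.left_lt_right
    rw [Fin.lt_def] at hlr
    rcases key e b hb with ⟨h1, h2, h3⟩ | ⟨h1, h2⟩ | ⟨b', h1, h2, h3⟩ <;>
      rcases key e c hc with ⟨h1', h2', h3'⟩ | ⟨h1', h2'⟩ | ⟨c', h1', h2', h3'⟩
    · exact hA.node_once e b c h2 h2'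
    · exact absurd h2'.1 (by omega)
    · omega
    · exact absurd h2.1 (by omega)
    · omega
    · exact absurd h2.2 (by omega)
    · omega
    · exact absurd h2'.2 (by omega)
    · rw [h1, h1', hB.node_once.mirror e b' c' h2 h2']

theorem exists_split_of_isChain {α : Type*} {R : α → α → Prop} {p : α → Prop}
    (hR : ∀ x y, R x y → ¬ p x → ¬ p y) (P : List α) (hP : P.IsChain R) :
    ∃ A C, P = A ++ C ∧ (∀ x ∈ A, p x) ∧ ∀ x ∈ C, ¬ p x := by
  induction P with
  | nil => exact ⟨[], [], rfl, by simp, by simp⟩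
  | cons x P ih =>
    obtain ⟨A, C, rfl, hA, hC⟩ := ih hP.tail
    by_cases hx : p x
    · refine ⟨x :: A, C, rfl, ?_, hC⟩
      simpa [hx] using hA
    · cases A with
      | nil => exact ⟨[], x :: C, rfl, by simp, by simpa [hx] using hC⟩
      | cons y A =>
        exact absurd (hA y (by simp)) (hR x y (List.isChain_cons_cons.1 hP).1 hx)

/-- A rigorous path in the `n`-th oriented diagram crosses the wall exactly once. -/
theorem exists_halfPaths (hi : IsReducedWord i) {P : List (Strand n)}
    (hP : P ∈ rigorousPaths i n) :
    ∃ (d : Node i) (A B : List (Strand n)), d.IsCentral ∧ IsHalfPath i d A ∧ IsHalfPath i d B ∧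
      P = A ++ mirror B := by
  obtain ⟨⟨x, hx, hx'⟩, ⟨y, hy, hy'⟩, hchain, honce⟩ := hP
  obtain ⟨A, C, rfl, hA, hC⟩ := exists_split_of_isChain (p := fun x : Strand n => n ≤ x.2.val)
    (fun x y h hx => not_le.2 (h.left_of_left hi (not_le.1 hx))) P hchain
  rw [List.isChain_append] at hchain
  obtain ⟨hcA, hcC, hAC⟩ := hchain
  rcases List.eq_nil_or_concat A with rfl | ⟨A, z, rfl⟩
  · exact absurd (hx'.right hi) (hC x (List.mem_of_mem_head? hx))
  rcases C with _ | ⟨w, C⟩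
  · rw [List.append_nil] at hy
    exact absurd (hA y (List.mem_of_mem_getLast? hy)) (not_le.2 (hy'.left hi))
  rw [List.concat_eq_append] at *
  obtain ⟨d, hd, hzw⟩ := (hAC z (by simp) w (by simp)).central_of_cross (hA z (by simp))
    (not_le.1 (hC w (by simp)))
  obtain ⟨hz2, hw2⟩ := hd.right_left_of_passes hi hzw
  refine ⟨d, A ++ [z], mirror (w :: C), hd, ⟨⟨x, by simpa using hx, hx'⟩, ⟨z, by simp, hzw.1, hz2⟩,
    hcA, NodeOnce.append_left honce, hA⟩, ⟨⟨reflect y, ?_, hy'.reflect_succ⟩, ⟨reflect w, ?_,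
    (enters_reflect _ _ _).2 hzw.2.1, ?_⟩, isChain_mirror hcC, (NodeOnce.append_right honce).mirror,
    ?_⟩, by rw [mirror_mirror]⟩
  · rw [List.getLast?_append_of_ne_nil _ (by simp)] at hy
    rw [mirror_eq, List.head?_reverse, List.getLast?_map, hy, Option.map_some]
  · simp [mirror_eq]
  · rw [reflect, hw2, hd.rev_left]
  · intro u hu
    rw [mirror_eq, List.mem_reverse, List.mem_map] at hu
    obtain ⟨u, hu, rfl⟩ := hu
    have := hC u hu
    rw [reflect, Fin.val_rev]
    omega

/-- For the same incoming wire all signs agree; for mirror wires the mixed passage is straight, with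
sign 0, while the two symmetric ones have opposite signs. -/
theorem crossSign_rev_right {m : ℕ} {r s : Fin m} (h : s = r ∨ s = r.rev) :
    crossSign r s.rev = (1 / 2) * (crossSign r r.rev + crossSign s s.rev) := by
  rcases h with rfl | rfl
  · ring
  · rw [Fin.rev_rev, crossSign_self]
    rcases lt_trichotomy r r.rev with h | h | h
    · rw [crossSign_of_lt h, crossSign_of_gt h]; ring
    · rw [← h, crossSign_self]; ring
    · rw [crossSign_of_gt h, crossSign_of_lt h]; ring

/-- Unfolded coordinates are invariant under reflection, so `mirror B` contributes as much as `B`;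
only the step through the central node needs `crossSign_rev_right`. -/
theorem IsHalfPath.stringFunctionA_append_mirror (hi : IsReducedWord i) {d : Node i}
    (hd : d.IsCentral) {A B : List (Strand n)} (hA : IsHalfPath i d A) (hB : IsHalfPath i d B)
    (a : Fin (n ^ 2) → ℝ) :
    stringFunctionA i n (A ++ mirror B) (unfoldCoords i a) =
      (1 / 2) * stringFunctionA i n (A ++ mirror A) (unfoldCoords i a) +
      (1 / 2) * stringFunctionA i n (B ++ mirror B) (unfoldCoords i a) := by
  rw [stringFunctionA_eq_pathSum (hA.append_mirror hi hd hB).node_once,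
    stringFunctionA_eq_pathSum (hA.append_mirror hi hd hA).node_once,
    stringFunctionA_eq_pathSum (hB.append_mirror hi hd hB).node_once]
  obtain ⟨x, hx, hx'⟩ := hA.ends
  obtain ⟨y, hy, hy'⟩ := hB.ends
  obtain ⟨A, rfl⟩ := List.getLast?_eq_some_iff.1 hx
  obtain ⟨B, rfl⟩ := List.getLast?_eq_some_iff.1 hy
  set f := stepWeight i n (unfoldCoords i a) with hf
  have hmir := pathSum_mirror (f := f) (stepWeight_reflect (unfoldCoords_mirror a))
  have h1 : ∀ (C : List (Strand n)) (z : Strand n), mirror (C ++ [z]) = reflect z :: mirror C := by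
    intro C z
    simp [mirror_eq]
  have h2 : ∀ (C D : List (Strand n)) (z u : Strand n), pathSum f (C ++ [z] ++ mirror (D ++ [u])) =
      pathSum f (C ++ [z]) + f z (reflect u) + pathSum f (D ++ [u]) := by
    intro C D z u
    rw [h1, pathSum_append, ← h1, hmir]
  have hw : wire i y = wire i x ∨ wire i y = (wire i x).rev := by
    have h3 : ∀ z : Strand n, Enters i n d.layer z ∧ z.2 = d.right →
        wire i z = wire i (d.layer.castSucc, d.left) ∨
        wire i z = (wire i (d.layer.castSucc, d.left)).rev := by
      rintro ⟨l, p⟩ ⟨h, rfl⟩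
      rcases h with ⟨-, h⟩ | ⟨-, h⟩
      · obtain rfl : l = _ := h
        exact Or.inl d.wire_lowerRight
      · obtain rfl : l = _ := h
        exact Or.inr hd.wire_right
    rcases h3 x hx' with h | h <;> rcases h3 y hy' with h' | h' <;> rw [h, h'] <;> simp
  have hc : f x (reflect y) = (1 / 2) * (f x (reflect x) + f y (reflect y)) := by
    rw [hf, stepWeight_of_passes _ (IsHalfPath.isStep hi hd hx' hy').1,
      stepWeight_of_passes _ (IsHalfPath.isStep hi hd hx' hx').1,
      stepWeight_of_passes _ (IsHalfPath.isStep hi hd hy' hy').1, wire_reflect, wire_reflect,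
      crossSign_rev_right hw]
    ring
  rw [h2, h2, h2, hc]
  ring

theorem isSymmetric_append_mirror (A : List (Strand n)) : IsSymmetric (A ++ mirror A) := by
  rw [IsSymmetric, mirror_append, mirror_mirror]

/-- The string function of a path which is not symmetric is the sum of those of two different
symmetric paths. -/
theorem exists_symmetric_decomposition (hi : IsReducedWord i) {P : List (Strand n)}
    (hP : P ∈ rigorousPaths i n) (hs : ¬ IsSymmetric P) :
    ∃ Q₁ ∈ rigorousPaths i n, ∃ Q₂ ∈ rigorousPaths i n, IsSymmetric Q₁ ∧ IsSymmetric Q₂ ∧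
      Q₁ ≠ Q₂ ∧ ∀ a : Fin (n ^ 2) → ℝ,
        stringFunctionC i n P a = stringFunctionC i n Q₁ a + stringFunctionC i n Q₂ a := by
  obtain ⟨d, A, B, hd, hA, hB, rfl⟩ := exists_halfPaths hi hP
  refine ⟨A ++ mirror A, hA.append_mirror hi hd hA, B ++ mirror B, hB.append_mirror hi hd hB,
    isSymmetric_append_mirror A, isSymmetric_append_mirror B, fun h => hs ?_, fun a => ?_⟩
  -- If the two symmetric paths coincide, equal lengths force `A = B`, and then the given path is
  -- symmetric.
  · have hlen := congrArg List.length h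
    simp only [List.length_append, length_mirror] at hlen
    rw [(List.append_inj h (by omega)).1]
    exact isSymmetric_append_mirror B
  · rw [stringFunctionC, stringFunctionC, stringFunctionC, if_neg hs,
      if_pos (isSymmetric_append_mirror A), if_pos (isSymmetric_append_mirror B)]
    exact hA.stringFunctionA_append_mirror hi hd hB a

/-! ## Potentials on the set of wires -/

theorem Enters.layer_unique {k : ℕ} {j j' : Fin (n ^ 2)} {x : Strand n} (h : Enters i k j x)
    (h' : Enters i k j' x) : j = j' := by
  rcases h with h | h <;> rcases h' with h' | h'
  · exact Fin.succ_injective _ (h.2.symm.trans h'.2)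
  · exact absurd h.1 h'.1
  · exact absurd h'.1 h.1
  · exact Fin.castSucc_injective _ (h.2.symm.trans h'.2)

theorem Leaves.layer_unique {k : ℕ} {j j' : Fin (n ^ 2)} {x : Strand n} (h : Leaves i k j x)
    (h' : Leaves i k j' x) : j = j' := by
  rcases h with h | h <;> rcases h' with h' | h'
  · exact Fin.castSucc_injective _ (h.2.symm.trans h'.2)
  · exact absurd h.1 h'.1
  · exact absurd h'.1 h.1
  · exact Fin.succ_injective _ (h.2.symm.trans h'.2)

theorem Node.wire_eq_or {d : Node i} {x : Strand n}
    (hl : x.1 = d.layer.castSucc ∨ x.1 = d.layer.succ) (hx : x.2 = d.left ∨ x.2 = d.right) :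
    wire i x = wire i (d.layer.castSucc, d.left) ∨
      wire i x = wire i (d.layer.castSucc, d.right) := by
  rcases x with ⟨l, p⟩
  dsimp only at hl hx
  rcases hl with rfl | rfl <;> rcases hx with rfl | rfl
  · exact Or.inl rfl
  · exact Or.inr rfl
  · exact Or.inr d.wire_lowerLeft
  · exact Or.inl d.wire_lowerRight

theorem Enters.level {k : ℕ} {j : Fin (n ^ 2)} {x : Strand n} (h : Enters i k j x) :
    x.1 = j.castSucc ∨ x.1 = j.succ :=
  h.symm.imp And.right And.right

theorem Leaves.level {k : ℕ} {j : Fin (n ^ 2)} {x : Strand n} (h : Leaves i k j x) :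
    x.1 = j.castSucc ∨ x.1 = j.succ :=
  h.imp And.right And.right

theorem wire_eq_of_fixed {j : Fin (n ^ 2)} {x : Strand n} (hs : simpleReflection n (i j) x.2 = x.2)
    (hl : x.1 = j.castSucc ∨ x.1 = j.succ) : wire i x = wire i (j.castSucc, x.2) := by
  rcases x with ⟨l, p⟩
  dsimp only at hl hs ⊢
  rcases hl with rfl | rfl
  · rfl
  · rw [wire_succ, hs]

/-- The differences of a function of the wires, as coordinates of the nodes. -/
def potentialCoords (i : Fin (n ^ 2) → Fin n) (h : Fin (2 * n) → ℝ) (d : Node i) : ℝ :=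
  h (wire i (d.layer.castSucc, d.right)) - h (wire i (d.layer.castSucc, d.left))

/-- The sign of a crossing cancels the choice of orienting the difference from left to right, which
relies on the left label being smaller. Straight passages give 0 on both sides. -/
theorem stepWeight_potentialCoords (hi : IsReducedWord i) (h : Fin (2 * n) → ℝ) {k : ℕ}
    {x y : Strand n} (hs : IsStep i k x y) :
    stepWeight i k (potentialCoords i h) x y = h (wire i y) - h (wire i x) := by
  rcases hs with ⟨j, hx, hy, hxy, hf⟩ | ⟨d, hd, -⟩
  · rw [stepWeight_of_not_passes, wire_eq_of_fixed hf hx.level,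
      wire_eq_of_fixed (hxy ▸ hf) hy.level, hxy, sub_self]
    intro d hd
    obtain rfl := hd.1.layer_unique hx
    exact Node.simpleReflection_ne hd.2.2.1 hf
  · rw [stepWeight_of_passes _ hd, potentialCoords]
    have hlt := d.wire_upperLeft_lt hi
    rcases Node.wire_eq_or hd.1.level hd.2.2.1 with h1 | h1 <;>
      rcases Node.wire_eq_or hd.2.1.level hd.2.2.2 with h2 | h2 <;> rw [h1, h2]
    · rw [crossSign_self]; ring
    · rw [crossSign_of_lt hlt]; ring
    · rw [crossSign_of_gt hlt]; ring
    · rw [crossSign_self]; ring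

theorem pathSum_telescope {α : Type*} {R : α → α → Prop} {f : α → α → ℝ} {g : α → ℝ}
    (hf : ∀ x y, R x y → f x y = g y - g x) {P : List α} (hP : P.IsChain R) {x y : α}
    (hx : P.head? = some x) (hy : P.getLast? = some y) : pathSum f P = g y - g x := by
  induction P generalizing x with
  | nil => simp at hx
  | cons z P ih =>
    obtain rfl : z = x := by simpa using hx
    cases P with
    | nil =>
      obtain rfl : z = y := by simpa using hy
      simp [pathSum]
    | cons w l =>
      rw [List.isChain_cons_cons] at hP
      rw [pathSum, hf _ _ hP.1, ih hP.2 rfl (by simpa using hy)]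
      ring

/-- The sum telescopes along the wires visited, so the value depends only on the two end labels and
not on the path. -/
theorem stringFunctionA_potentialCoords (hi : IsReducedWord i) (h : Fin (2 * n) → ℝ) {k : ℕ}
    {P : List (Strand n)} (hP : P ∈ rigorousPaths i k) (r s : Fin (2 * n)) (hr : r.val + 1 = k)
    (hs : s.val = k) : stringFunctionA i k P (potentialCoords i h) = h s - h r := by
  rw [stringFunctionA_eq_pathSum hP.node_once]
  obtain ⟨x, hx, hx'⟩ := hP.starts
  obtain ⟨y, hy, hy'⟩ := hP.ends
  rw [pathSum_telescope (g := fun x => h (wire i x))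
    (fun x y hxy => stepWeight_potentialCoords hi h hxy) hP.isChain hx hy]
  have h1 : wire i x = r := Fin.ext (by have := hx'.2; omega)
  have h2 : wire i y = s := Fin.ext (by have := hy'.2; omega)
  simp only [h1, h2]

theorem potentialCoords_mirror {h : Fin (2 * n) → ℝ} (hh : ∀ r : Fin (2 * n), h r.rev = -h r)
    (d : Node i) : potentialCoords i h d.mirror = potentialCoords i h d := by
  rw [potentialCoords, potentialCoords, Node.layer_mirror, Node.left_mirror, Node.right_mirror,
    wire_rev, wire_rev, hh, hh]
  ring

/-- Oddness makes the coordinates mirror invariant, and the nodes of one layer are mirror images of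
each other, so one value per layer suffices; it is halved in central layers, where unfolding
doubles. -/
theorem exists_unfoldCoords_eq_potentialCoords (i : Fin (n ^ 2) → Fin n) {h : Fin (2 * n) → ℝ}
    (hh : ∀ r : Fin (2 * n), h r.rev = -h r) :
    ∃ a : Fin (n ^ 2) → ℝ, unfoldCoords i a = potentialCoords i h := by
  have hnode : ∀ j : Fin (n ^ 2), ∃ d : Node i, d.layer = j := fun j =>
    ⟨⟨(j, ⟨(i j).val, by omega⟩), (lt_simpleReflection_iff _ _).2 (Or.inl rfl)⟩, rfl⟩
  choose e he using hnode
  refine ⟨fun j => if (i j).val + 1 = n then potentialCoords i h (e j) / 2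
    else potentialCoords i h (e j), funext fun d => ?_⟩
  have h1 : potentialCoords i h (e d.layer) = potentialCoords i h d := by
    rcases Node.eq_or_eq_mirror (he d.layer) with h | h <;> rw [h]
    exact potentialCoords_mirror hh d
  rw [unfoldCoords]
  split_ifs
  · rw [h1]; ring
  · exact h1

/-! ## The strands of a rigorous path at a node -/

theorem IsStep.of_enters {k : ℕ} {j : Fin (n ^ 2)} {x y : Strand n} (h : IsStep i k x y)
    (hx : Enters i k j x) : Leaves i k j y ∧ ((x.2 = y.2 ∧ simpleReflection n (i j) x.2 = x.2) ∨
      ∃ d : Node i, d.layer = j ∧ PassesNode i k d x y ∧ ¬ IsForbidden i k d x y) := by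
  rcases h with ⟨j', hx', hy, hxy⟩ | ⟨d, hd, hf⟩
  · obtain rfl := hx.layer_unique hx'
    exact ⟨hy, Or.inl hxy⟩
  · obtain rfl := hx.layer_unique hd.1
    exact ⟨hd.2.1, Or.inr ⟨d, rfl, hd, hf⟩⟩

theorem IsStep.enters_of_leaves {k : ℕ} {j : Fin (n ^ 2)} {x y : Strand n} (h : IsStep i k x y)
    (hy : Leaves i k j y) : Enters i k j x := by
  rcases h with ⟨j', hx', hy', hxy⟩ | ⟨d, hd, hf⟩
  · obtain rfl := hy.layer_unique hy'
    exact hx'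
  · obtain rfl := hy.layer_unique hd.2.1
    exact hd.1

theorem IsRigorousPath.isStep {k : ℕ} {P : List (Strand n)} (hP : IsRigorousPath i k P) {b : ℕ}
    (hb : b + 1 < P.length) : IsStep i k P[b] P[b + 1] :=
  List.isChain_iff_getElem.1 hP.isChain b hb

theorem IsRigorousPath.exists_next {k : ℕ} {P : List (Strand n)} (hP : IsRigorousPath i k P)
    {j : Fin (n ^ 2)} {b : ℕ} (hb : b < P.length) (h : Enters i k j P[b]) : b + 1 < P.length := by
  by_contra hb'
  obtain ⟨x, hx, hx'⟩ := hP.ends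
  rw [List.getLast?_eq_getElem?, show P.length - 1 = b by omega,
    List.getElem?_eq_getElem hb] at hx
  rw [Option.some.inj hx] at h
  have h1 := hx'.2
  rcases h with h | h
  · have := h.1
    rw [IsUp] at this
    omega
  · have h2 := h.2.symm.trans hx'.1
    rw [Fin.ext_iff] at h2
    simp at h2
    omega

theorem IsRigorousPath.exists_prev {k : ℕ} {P : List (Strand n)} (hP : IsRigorousPath i k P)
    {j : Fin (n ^ 2)} {b : ℕ} (hb : b < P.length) (h : Leaves i k j P[b]) : ∃ c, b = c + 1 := by
  cases b with
  | succ c => exact ⟨c, rfl⟩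
  | zero =>
    obtain ⟨x, hx, hx'⟩ := hP.starts
    rw [List.head?_eq_getElem?, List.getElem?_eq_getElem hb] at hx
    rw [Option.some.inj hx] at h
    have h1 := hx'.2
    rcases h with h | h
    · have h2 := h.2.symm.trans hx'.1
      rw [Fin.ext_iff] at h2
      simp at h2
      omega
    · have := h.1
      rw [IsUp] at this
      omega

/-- An upward strand at the top leads out of the diagram and a downward one there has no
predecessor, while both ends of the path are at the bottom. This is the base case for comparing
paths level by level. -/
theorem IsRigorousPath.top_not_mem {k : ℕ} {P : List (Strand n)} (hP : IsRigorousPath i k P)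
    {x : Strand n} (hx : x.1 = 0) : x ∉ P := by
  intro h
  obtain ⟨b, hb, rfl⟩ := List.getElem_of_mem h
  by_cases hu : IsUp k (wire i P[b])
  · by_cases hb' : b + 1 < P.length
    · have h1 : ∃ j, Enters i k j P[b] := by
        rcases hP.isStep hb' with ⟨j, h, -⟩ | ⟨d, h, -⟩
        exacts [⟨j, h⟩, ⟨_, h.1⟩]
      obtain ⟨j, h1⟩ := h1
      rcases h1 with h1 | h1
      · exact Fin.succ_ne_zero j (h1.2.symm.trans hx)
      · exact h1.1 hu
    · obtain ⟨y, hy, hy'⟩ := hP.ends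
      rw [List.getLast?_eq_getElem?, show P.length - 1 = b by omega,
        List.getElem?_eq_getElem hb] at hy
      rw [Option.some.inj hy, IsUp] at hu
      have := hy'.2
      omega
  · cases b with
    | zero =>
      obtain ⟨y, hy, hy'⟩ := hP.starts
      rw [List.head?_eq_getElem?, List.getElem?_eq_getElem hb] at hy
      rw [Option.some.inj hy, IsUp] at hu
      have := hy'.2
      omega
    | succ c =>
      have h1 : ∃ j, Leaves i k j P[c + 1] := by
        rcases hP.isStep hb with ⟨j, -, h, -⟩ | ⟨d, h, -⟩
        exacts [⟨j, h⟩, ⟨_, h.2.1⟩]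
      obtain ⟨j, h1⟩ := h1
      rcases h1 with h1 | h1
      · exact hu h1.1
      · exact Fin.succ_ne_zero j (h1.2.symm.trans hx)

theorem strand_eq_of_leaves {k : ℕ} {j : Fin (n ^ 2)} {x y : Strand n} (hx : Leaves i k j x)
    (hy : Leaves i k j y) (h2 : x.2 = y.2) (hs : simpleReflection n (i j) x.2 = x.2) : x = y := by
  have hw : wire i x = wire i y := by
    rw [wire_eq_of_fixed hs hx.level, wire_eq_of_fixed (h2 ▸ hs) hy.level, h2]
  refine Prod.ext ?_ h2
  rcases hx with hx | hx <;> rcases hy with hy | hy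
  · exact hx.2.trans hy.2.symm
  · exact absurd (hw ▸ hx.1) hy.1
  · exact absurd (hw ▸ hy.1) hx.1
  · exact hx.2.trans hy.2.symm

theorem strand_eq_of_enters {k : ℕ} {j : Fin (n ^ 2)} {x y : Strand n} (hx : Enters i k j x)
    (hy : Enters i k j y) (h2 : x.2 = y.2) (hs : simpleReflection n (i j) x.2 = x.2) : x = y := by
  have hw : wire i x = wire i y := by
    rw [wire_eq_of_fixed hs hx.level, wire_eq_of_fixed (h2 ▸ hs) hy.level, h2]
  refine Prod.ext ?_ h2
  rcases hx with hx | hx <;> rcases hy with hy | hy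
  · exact hx.2.trans hy.2.symm
  · exact absurd (hw ▸ hx.1) hy.1
  · exact absurd (hw ▸ hy.1) hx.1
  · exact hx.2.trans hy.2.symm

theorem IsRigorousPath.mem_iff_of_fixed {k : ℕ} {P : List (Strand n)} (hP : IsRigorousPath i k P)
    {j : Fin (n ^ 2)} {x y : Strand n} (hx : Enters i k j x) (hy : Leaves i k j y)
    (h2 : x.2 = y.2) (hs : simpleReflection n (i j) x.2 = x.2) : x ∈ P ↔ y ∈ P := by
  constructor
  · intro h
    obtain ⟨b, hb, rfl⟩ := List.getElem_of_mem h
    have hb' := hP.exists_next hb hx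
    obtain ⟨hl, ⟨h3, -⟩ | ⟨d, rfl, hd, -⟩⟩ := (hP.isStep hb').of_enters hx
    · rw [strand_eq_of_leaves hy hl (h2.symm.trans h3) (h2 ▸ hs)]
      exact List.getElem_mem hb'
    · exact absurd hs (Node.simpleReflection_ne hd.2.2.1)
  · intro h
    obtain ⟨b, hb, rfl⟩ := List.getElem_of_mem h
    obtain ⟨c, rfl⟩ := hP.exists_prev hb hy
    have hstep := hP.isStep hb
    have he := hstep.enters_of_leaves hy
    obtain ⟨hl, ⟨h3, -⟩ | ⟨d, rfl, hd, -⟩⟩ := hstep.of_enters he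
    · rw [strand_eq_of_enters hx he (h2.trans h3.symm) hs]
      exact List.getElem_mem _
    · exact absurd (h2 ▸ hs) (Node.simpleReflection_ne hd.2.2.2)

theorem IsRigorousPath.upper_mem_iff_lower_mem {k : ℕ} {P : List (Strand n)}
    (hP : IsRigorousPath i k P) {j : Fin (n ^ 2)} {p : Fin (2 * n)}
    (hs : simpleReflection n (i j) p = p) : (j.castSucc, p) ∈ P ↔ (j.succ, p) ∈ P := by
  have hw : wire i (j.succ, p) = wire i (j.castSucc, p) := by rw [wire_succ, hs]
  by_cases hu : IsUp k (wire i (j.castSucc, p))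
  · exact (hP.mem_iff_of_fixed (x := (j.succ, p)) (y := (j.castSucc, p))
      (Or.inl ⟨hw ▸ hu, rfl⟩) (Or.inl ⟨hu, rfl⟩) rfl hs).symm
  · exact hP.mem_iff_of_fixed (x := (j.castSucc, p)) (y := (j.succ, p))
      (Or.inr ⟨hu, rfl⟩) (Or.inr ⟨hw ▸ hu, rfl⟩) rfl hs

/-- A rigorous path either avoids a node or passes through it exactly once. -/
theorem IsRigorousPath.avoids_or_passes {k : ℕ} {P : List (Strand n)} (hP : IsRigorousPath i k P)
    (d : Node i) :
    (coeff i k P d = 0 ∧ ∀ z : Strand n, z.2 = d.left ∨ z.2 = d.right →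
      Enters i k d.layer z ∨ Leaves i k d.layer z → z ∉ P) ∨
    ∃ x y, PassesNode i k d x y ∧ ¬ IsForbidden i k d x y ∧
      coeff i k P d = crossSign (wire i x) (wire i y) ∧
      ∀ z : Strand n, z.2 = d.left ∨ z.2 = d.right →
        (Enters i k d.layer z → (z ∈ P ↔ z = x)) ∧ (Leaves i k d.layer z → (z ∈ P ↔ z = y)) := by
  have henter : ∀ b (hb : b < P.length), (P[b].2 = d.left ∨ P[b].2 = d.right) →
      Enters i k d.layer P[b] → ∃ hb' : b + 1 < P.length, PassesNode i k d P[b] P[b + 1] ∧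
        ¬ IsForbidden i k d P[b] P[b + 1] := by
    intro b hb hz he
    have hb' := hP.exists_next hb he
    refine ⟨hb', ?_⟩
    obtain ⟨-, ⟨-, h⟩ | ⟨e, hed, hp, hf⟩⟩ := (hP.isStep hb').of_enters he
    · exact absurd h (Node.simpleReflection_ne hz)
    · obtain rfl := Node.eq_of_mem hed hp.2.2.1 hz
      exact ⟨hp, hf⟩
  have hleave : ∀ b (hb : b < P.length), (P[b].2 = d.left ∨ P[b].2 = d.right) →
      Leaves i k d.layer P[b] → ∃ c, b = c + 1 ∧ PassesAt i k P d c := by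
    intro b hb hz hl
    obtain ⟨c, rfl⟩ := hP.exists_prev hb hl
    have he := (hP.isStep hb).enters_of_leaves hl
    refine ⟨c, rfl, hb, ?_⟩
    obtain ⟨-, ⟨h1, h⟩ | ⟨e, hed, hp, hf⟩⟩ := (hP.isStep hb).of_enters he
    · exact absurd (h1 ▸ h) (Node.simpleReflection_ne hz)
    · obtain rfl := Node.eq_of_mem hed hp.2.2.2 hz
      exact hp
  by_cases h : ∃ b, PassesAt i k P d b
  · right
    obtain ⟨b, hb, hd⟩ := h
    obtain ⟨_, _, hf⟩ := henter b (by omega) hd.2.2.1 hd.1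
    refine ⟨P[b], P[b + 1], hd, hf, coeff_of_passes hP.node_once hb hd, fun z hz => ⟨?_, ?_⟩⟩
    · refine fun he => ⟨fun hm => ?_, fun h => h ▸ List.getElem_mem _⟩
      obtain ⟨c, hc, rfl⟩ := List.getElem_of_mem hm
      obtain ⟨hc', hp, -⟩ := henter c hc hz he
      obtain rfl := hP.node_once d b c ⟨hb, hd⟩ ⟨hc', hp⟩
      rfl
    · refine fun hl => ⟨fun hm => ?_, fun h => h ▸ List.getElem_mem _⟩
      obtain ⟨c, hc, rfl⟩ := List.getElem_of_mem hm
      obtain ⟨c, rfl, hp⟩ := hleave c hc hz hl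
      obtain rfl := hP.node_once d b c ⟨hb, hd⟩ hp
      rfl
  · left
    refine ⟨coeff_of_not_passes fun b hb => h ⟨b, hb⟩, fun z hz hel hm => ?_⟩
    obtain ⟨c, hc, rfl⟩ := List.getElem_of_mem hm
    rcases hel with he | hl
    · obtain ⟨hc', hp, -⟩ := henter c hc hz he
      exact h ⟨c, hc', hp⟩
    · obtain ⟨c, -, hp⟩ := hleave c hc hz hl
      exact h ⟨c, hp⟩

/-! ### Comparing two paths through their occupied strands -/

/-- The strands occupied by the family of non-crossing paths that corresponds to a path `P` in the
`k`-th oriented diagram: the symmetric difference of `P` and the upward strands. -/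
def Occupied (i : Fin (n ^ 2) → Fin n) (k : ℕ) (P : List (Strand n)) (x : Strand n) : Prop :=
  ¬ (x ∈ P ↔ IsUp k (wire i x))

theorem occupied_iff_occupied {k : ℕ} {P Q : List (Strand n)} {x : Strand n} :
    (Occupied i k P x ↔ Occupied i k Q x) ↔ (x ∈ P ↔ x ∈ Q) := by
  unfold Occupied
  tauto

/-- `(ul, ur, ll, lr)` are the occupied strands at the node `d` and `c` is its coefficient. -/
def HasTrace (i : Fin (n ^ 2) → Fin n) (k : ℕ) (P : List (Strand n)) (d : Node i)
    (ul ur ll lr : Prop) (c : ℝ) : Prop :=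
  (Occupied i k P (d.layer.castSucc, d.left) ↔ ul) ∧
  (Occupied i k P (d.layer.castSucc, d.right) ↔ ur) ∧
  (Occupied i k P (d.layer.succ, d.left) ↔ ll) ∧
  (Occupied i k P (d.layer.succ, d.right) ↔ lr) ∧ coeff i k P d = c

/-- The possible traces of a rigorous path at a node. -/
theorem IsRigorousPath.hasTrace (hi : IsReducedWord i) {k : ℕ} {P : List (Strand n)}
    (hP : IsRigorousPath i k P) (d : Node i) :
    HasTrace i k P d False False False False 0 ∨ HasTrace i k P d True True True True 0 ∨
    HasTrace i k P d True False True False 1 ∨ HasTrace i k P d True False False True 0 ∨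
    HasTrace i k P d False True False True (-1) := by
  have hlt := d.wire_upperLeft_lt hi
  have hne := d.left_lt_right.ne
  have hls : d.layer.castSucc ≠ d.layer.succ := Fin.castSucc_lt_succ.ne
  have huv : IsUp k (wire i (d.layer.castSucc, d.right)) →
      IsUp k (wire i (d.layer.castSucc, d.left)) := by
    unfold IsUp
    rw [Fin.lt_def] at hlt
    omega
  have e1 := d.enters_left k
  have e2 := d.enters_right k
  have e3 := d.leaves_left k
  have e4 := d.leaves_right k
  unfold HasTrace Occupied
  rw [d.wire_lowerLeft, d.wire_lowerRight]
  -- An upward right wire forces an upward left wire, its label being smaller; three orientation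
  -- patterns remain. The absent trace from upper right to lower left is what the forbidden
  -- fragments exclude.
  by_cases hu : IsUp k (wire i (d.layer.castSucc, d.left)) <;>
  by_cases hv : IsUp k (wire i (d.layer.castSucc, d.right)) <;>
  [skip; skip; exact absurd (huv hv) hu; skip]
  all_goals
    simp only [hu, hv, not_true, not_false_eq_true, and_true, and_false, or_false, false_or]
      at e1 e2 e3 e4
    rcases hP.avoids_or_passes d with ⟨hc, hz⟩ | ⟨x, y, hd, hf, hc, hz⟩
    · have a1 := hz (d.layer.castSucc, d.left) (Or.inl rfl) (by simp [e1, e3])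
      have a2 := hz (d.layer.castSucc, d.right) (Or.inr rfl) (by simp [e2, e4])
      have a3 := hz (d.layer.succ, d.left) (Or.inl rfl) (by simp [e1, e3])
      have a4 := hz (d.layer.succ, d.right) (Or.inr rfl) (by simp [e2, e4])
      simp [a1, a2, a3, a4, hc, hu, hv]
    · have a1 := hz (d.layer.castSucc, d.left) (Or.inl rfl)
      have a2 := hz (d.layer.castSucc, d.right) (Or.inr rfl)
      have a3 := hz (d.layer.succ, d.left) (Or.inl rfl)
      have a4 := hz (d.layer.succ, d.right) (Or.inr rfl)
      obtain ⟨hx, hy, hx', hy'⟩ := hd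
      rcases x with ⟨l, p⟩
      rcases y with ⟨m, q⟩
      dsimp only at hx' hy'
      have hl := hx.level
      have hm := hy.level
      dsimp only at hl hm
      rcases hx' with rfl | rfl <;> rcases hy' with rfl | rfl <;>
        rcases hl with rfl | rfl <;> rcases hm with rfl | rfl <;>
        simp [e1, e2, e3, e4, hne, hne.symm, hls, hls.symm, IsForbidden, hu, hv, d.wire_lowerLeft,
          d.wire_lowerRight, crossSign_self, crossSign_of_lt hlt, crossSign_of_gt hlt]
          at hx hy a1 a2 a3 a4 hc hf <;>
        simp [a1, a2, a3, a4, hc, hu, hv]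

/-- If two rigorous paths agree above a node, then they agree at the node, or their coefficients
are `0` and `1`. -/
theorem IsRigorousPath.compare (hi : IsReducedWord i) {k : ℕ} {P Q : List (Strand n)}
    (hP : IsRigorousPath i k P) (hQ : IsRigorousPath i k Q) (d : Node i)
    (h : ∀ p, (d.layer.castSucc, p) ∈ P ↔ (d.layer.castSucc, p) ∈ Q) :
    (coeff i k P d = coeff i k Q d ∧
      ((d.layer.succ, d.left) ∈ P ↔ (d.layer.succ, d.left) ∈ Q) ∧
      ((d.layer.succ, d.right) ∈ P ↔ (d.layer.succ, d.right) ∈ Q)) ∨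
    (coeff i k P d = 0 ∧ coeff i k Q d = 1) ∨ (coeff i k P d = 1 ∧ coeff i k Q d = 0) := by
  have h1 := (occupied_iff_occupied (i := i) (k := k)).2 (h d.left)
  have h2 := (occupied_iff_occupied (i := i) (k := k)).2 (h d.right)
  rw [← occupied_iff_occupied (i := i) (k := k), ← occupied_iff_occupied (i := i) (k := k)]
  rcases hP.hasTrace hi d with h3 | h3 | h3 | h3 | h3 <;>
  rcases hQ.hasTrace hi d with h4 | h4 | h4 | h4 | h4 <;>
  (obtain ⟨b1, b2, b3, b4, b5⟩ := h3
   obtain ⟨c1, c2, c3, c4, c5⟩ := h4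
   rw [b1, c1] at h1
   rw [b2, c2] at h2
   rw [b3, b4, b5, c3, c4, c5]
   simp_all)

theorem IsRigorousPath.mem_succ_iff (hi : IsReducedWord i) {k : ℕ} {P Q : List (Strand n)}
    (hP : IsRigorousPath i k P) (hQ : IsRigorousPath i k Q) (j : Fin (n ^ 2))
    (h : ∀ p, (j.castSucc, p) ∈ P ↔ (j.castSucc, p) ∈ Q)
    (hc : ∀ d : Node i, d.layer = j → coeff i k P d = coeff i k Q d) (p : Fin (2 * n)) :
    (j.succ, p) ∈ P ↔ (j.succ, p) ∈ Q := by
  by_cases hs : simpleReflection n (i j) p = p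
  · rw [← hP.upper_mem_iff_lower_mem hs, ← hQ.upper_mem_iff_lower_mem hs, h]
  · obtain ⟨d, rfl, hp⟩ := Node.exists_of_moved j p hs
    have := hc d rfl
    rcases hP.compare hi hQ d h with ⟨-, h1, h2⟩ | ⟨h1, h2⟩ | ⟨h1, h2⟩
    · rcases hp with rfl | rfl
      exacts [h1, h2]
    · rw [h1, h2] at this; norm_num at this
    · rw [h1, h2] at this; norm_num at this

/-- Both paths start at the same lower end. At each node the next strand is forced, since a single
passage leaves exactly one outgoing strand in the common strand set. -/
theorem IsRigorousPath.getElem_eq_of_mem_iff {k : ℕ} {P Q : List (Strand n)}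
    (hP : IsRigorousPath i k P) (hQ : IsRigorousPath i k Q) (h : ∀ x, x ∈ P ↔ x ∈ Q) (b : ℕ)
    (hb : b < P.length) : ∃ hb' : b < Q.length, P[b] = Q[b] := by
  induction b with
  | zero =>
    obtain ⟨x, hx, hx'⟩ := hP.starts
    obtain ⟨y, hy, hy'⟩ := hQ.starts
    have hQ0 : 0 < Q.length := by
      rcases Q with _ | ⟨z, Q⟩
      · simp at hy
      · simp
    rw [List.head?_eq_getElem?, List.getElem?_eq_getElem (by omega)] at hx hy
    exact ⟨hQ0, by rw [Option.some.inj hx, Option.some.inj hy, hx'.eq hy']⟩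
  | succ b ih =>
    obtain ⟨hb', heq⟩ := ih (by omega)
    have hs := hP.isStep hb
    obtain ⟨j, hx⟩ : ∃ j, Enters i k j P[b] := by
      rcases hs with ⟨j, h, -⟩ | ⟨d, h, -⟩
      exacts [⟨j, h⟩, ⟨_, h.1⟩]
    have hb1 := hQ.exists_next hb' (heq ▸ hx)
    refine ⟨hb1, ?_⟩
    have hs' := hQ.isStep hb1
    obtain ⟨hl, h1⟩ := hs.of_enters hx
    obtain ⟨hl', h2⟩ := hs'.of_enters (heq ▸ hx)
    rw [← heq] at h2
    rcases h1 with ⟨h1, hf⟩ | ⟨d, rfl, hd, -⟩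
    · rcases h2 with ⟨h2, -⟩ | ⟨d, rfl, hd, -⟩
      · exact strand_eq_of_leaves hl hl' (h1.symm.trans h2) (h1 ▸ hf)
      · exact absurd hf (Node.simpleReflection_ne hd.2.2.1)
    · rcases h2 with ⟨-, hf⟩ | ⟨e, hed, he, -⟩
      · exact absurd hf (Node.simpleReflection_ne hd.2.2.1)
      · obtain rfl := Node.eq_of_mem hed he.2.2.1 hd.2.2.1
        rcases hP.avoids_or_passes e with ⟨-, hz⟩ | ⟨x, y, -, -, -, hz⟩
        · exact absurd (List.getElem_mem _) (hz P[b] hd.2.2.1 (Or.inl hd.1))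
        · rw [((hz _ hd.2.2.2).2 hd.2.1).1 (List.getElem_mem _),
            ((hz _ he.2.2.2).2 he.2.1).1 ((h _).2 (List.getElem_mem _))]

/-- A rigorous path is determined by the set of its strands. -/
theorem IsRigorousPath.eq_of_mem_iff {k : ℕ} {P Q : List (Strand n)}
    (hP : IsRigorousPath i k P) (hQ : IsRigorousPath i k Q) (h : ∀ x, x ∈ P ↔ x ∈ Q) : P = Q := by
  have h1 := hP.getElem_eq_of_mem_iff hQ h
  have h2 := hQ.getElem_eq_of_mem_iff hP fun x => (h x).symm
  refine List.ext_getElem (le_antisymm ?_ ?_) fun b hb _ => (h1 b hb).2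
  · by_contra hlt
    obtain ⟨h3, -⟩ := h1 Q.length (by omega)
    omega
  · by_contra hlt
    obtain ⟨h3, -⟩ := h2 P.length (by omega)
    omega

theorem IsRigorousPath.mem_level_iff (hi : IsReducedWord i) {k : ℕ} {P Q : List (Strand n)}
    (hP : IsRigorousPath i k P) (hQ : IsRigorousPath i k Q) (h : ℕ) (hh : h < n ^ 2 + 1)
    (hc : ∀ d : Node i, d.layer.val < h → coeff i k P d = coeff i k Q d) (p : Fin (2 * n)) :
    ((⟨h, hh⟩ : Fin (n ^ 2 + 1)), p) ∈ P ↔ ((⟨h, hh⟩ : Fin (n ^ 2 + 1)), p) ∈ Q := by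
  induction h generalizing p with
  | zero => exact iff_of_false (hP.top_not_mem rfl) (hQ.top_not_mem rfl)
  | succ h ih =>
    refine hP.mem_succ_iff hi hQ ⟨h, by omega⟩
      (ih (by omega) fun d hd => hc d (by omega)) (fun d hd => hc d ?_) p
    rw [hd]
    exact Nat.lt_succ_self h

/-- At the first layer in which two rigorous paths differ, the coefficients are `0` and `1`. -/
theorem IsRigorousPath.exists_first_difference (hi : IsReducedWord i) {k : ℕ}
    {P Q : List (Strand n)} (hP : IsRigorousPath i k P) (hQ : IsRigorousPath i k Q) (hPQ : P ≠ Q) :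
    ∃ d₀ : Node i, coeff i k P d₀ ≠ coeff i k Q d₀ ∧
      (∀ d : Node i, d.layer < d₀.layer → coeff i k P d = coeff i k Q d) ∧
      ∀ d : Node i, d.layer = d₀.layer → coeff i k P d ≠ coeff i k Q d →
        (coeff i k P d = 0 ∧ coeff i k Q d = 1) ∨ (coeff i k P d = 1 ∧ coeff i k Q d = 0) := by
  have hex : ∃ d : Node i, coeff i k P d ≠ coeff i k Q d := by
    by_contra hno
    push Not at hno
    refine hPQ (hP.eq_of_mem_iff hQ fun x => ?_)
    exact hP.mem_level_iff hi hQ x.1.val x.1.isLt (fun d _ => hno d) x.2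
  obtain ⟨d₀, hd₀, hmin⟩ := Set.exists_min_image {d : Node i | coeff i k P d ≠ coeff i k Q d}
    Node.layer (Set.toFinite _) hex
  have hlow : ∀ d : Node i, d.layer < d₀.layer → coeff i k P d = coeff i k Q d := fun d hd => by
    by_contra hne
    exact absurd (hmin d hne) (not_le.2 hd)
  refine ⟨d₀, hd₀, hlow, fun d hd hne => ?_⟩
  refine (hP.compare hi hQ d fun p => ?_).resolve_left fun h => hne h.1
  exact hP.mem_level_iff hi hQ d.layer.val _ (fun e he => hlow e (hd ▸ he)) p

/-! ### Mirror invariance of the coefficients of a symmetric path -/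

theorem travels_mirror {P : List (Strand n)} {d : Node i} {r s : Fin (2 * n)}
    (h : Travels i n P d r s) : Travels i n (mirror P) d.mirror s.rev r.rev := by
  obtain ⟨b, hb, hd, rfl, rfl⟩ := h
  have h1 : ∀ c (hc : c < (mirror P).length), (mirror P)[c] =
      reflect (P[P.length - 1 - c]'(by rw [length_mirror] at hc; omega)) := by
    intro c hc
    simp [mirror_eq]
  refine ⟨P.length - 2 - b, by rw [length_mirror]; omega, ?_⟩
  have e1 : P.length - 1 - (P.length - 2 - b) = b + 1 := by omega
  have e2 : P.length - 1 - (P.length - 2 - b + 1) = b := by omega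
  rw [h1, h1]
  simp only [e1, e2]
  exact ⟨(passesNode_reflect _ _ _).2 hd, wire_reflect _ _, wire_reflect _ _⟩

theorem IsSymmetric.coeff_mirror {P : List (Strand n)} (hP : IsSymmetric P) (d : Node i) :
    coeff i n P d.mirror = coeff i n P d := by
  have key : ∀ r s, Travels i n P d.mirror s.rev r.rev ↔ Travels i n P d r s := by
    intro r s
    constructor
    · intro h
      have := travels_mirror h
      rwa [← hP, Node.mirror_mirror, Fin.rev_rev, Fin.rev_rev] at this
    · intro h
      have := travels_mirror h
      rwa [← hP] at this
  have key1 : (∃ r s, r < s ∧ Travels i n P d.mirror r s) ↔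
      ∃ r s, r < s ∧ Travels i n P d r s := by
    constructor
    · rintro ⟨r, s, hrs, h⟩
      exact ⟨s.rev, r.rev, Fin.rev_lt_rev.2 hrs, (key _ _).1 (by simpa using h)⟩
    · rintro ⟨r, s, hrs, h⟩
      exact ⟨s.rev, r.rev, Fin.rev_lt_rev.2 hrs, (key _ _).2 h⟩
  have key2 : (∃ r s, s < r ∧ Travels i n P d.mirror r s) ↔
      ∃ r s, s < r ∧ Travels i n P d r s := by
    constructor
    · rintro ⟨r, s, hrs, h⟩
      exact ⟨s.rev, r.rev, Fin.rev_lt_rev.2 hrs, (key _ _).1 (by simpa using h)⟩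
    · rintro ⟨r, s, hrs, h⟩
      exact ⟨s.rev, r.rev, Fin.rev_lt_rev.2 hrs, (key _ _).2 h⟩
  classical exact if_congr key1 rfl (if_congr key2 rfl rfl)

/-! ## Separating a symmetric path -/

/-- The worst case is the geometric sum of `C * (C + 1) ^ m` over `m < N`, which equals `(C + 1) ^ N
- 1`. -/
theorem one_le_sum_add_pow {C : ℝ} (hC : 0 ≤ C) {N : ℕ} (X : Fin N → ℝ) (hX : ∀ j, -C ≤ X j) :
    1 ≤ ∑ j, X j * (C + 1) ^ j.rev.val + (C + 1) ^ N := by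
  induction N with
  | zero => simp
  | succ N ih =>
    have h1 := ih (fun j => X j.succ) fun j => hX _
    have h2 : 0 ≤ (X 0 + C) * (C + 1) ^ N :=
      mul_nonneg (by linarith [hX 0]) (pow_nonneg (by linarith) _)
    rw [Fin.sum_univ_succ]
    simp only [Fin.rev_succ, Fin.val_castSucc, Fin.rev_zero, Fin.val_last]
    rw [pow_succ]
    linarith

/-- Lexicographic domination: with base `C + 1`, the first nonzero term outweighs all later ones
bounded below by `-C`. -/
theorem one_le_sum_of_first {C : ℝ} (hC : 0 ≤ C) {N : ℕ} (X : Fin N → ℝ) (j₀ : Fin N)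
    (hlow : ∀ j < j₀, X j = 0) (hj₀ : 1 ≤ X j₀) (hX : ∀ j, -C ≤ X j) :
    1 ≤ ∑ j, X j * (C + 1) ^ j.rev.val := by
  induction N with
  | zero => exact j₀.elim0
  | succ N ih =>
    rw [Fin.sum_univ_succ]
    simp only [Fin.rev_succ, Fin.val_castSucc, Fin.rev_zero, Fin.val_last]
    cases j₀ using Fin.cases with
    | zero =>
      have h1 := one_le_sum_add_pow hC (fun j => X j.succ) fun j => hX _
      have h2 : 0 ≤ (X 0 - 1) * (C + 1) ^ N :=
        mul_nonneg (by linarith) (pow_nonneg (by linarith) _)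
      linarith
    | succ j₀ =>
      rw [hlow 0 (Fin.succ_pos _), zero_mul, zero_add]
      exact ih (fun j => X j.succ) j₀ (fun j hj => hlow _ (Fin.succ_lt_succ_iff.2 hj)) hj₀
        fun j => hX _

theorem abs_coeff_le_one {k : ℕ} (P : List (Strand n)) (d : Node i) : |coeff i k P d| ≤ 1 := by
  unfold coeff
  split_ifs <;> simp

theorem stringFunctionA_add (k : ℕ) (P : List (Strand n)) (t u : Node i → ℝ) :
    stringFunctionA i k P (t + u) = stringFunctionA i k P t + stringFunctionA i k P u := by
  simp only [stringFunctionA, Pi.add_apply, mul_add, Finset.sum_add_distrib]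

theorem unfoldCoords_add (a b : Fin (n ^ 2) → ℝ) :
    unfoldCoords i (a + b) = unfoldCoords i a + unfoldCoords i b := by
  funext d
  simp only [unfoldCoords, Pi.add_apply]
  split_ifs <;> ring

theorem neg_sum_abs_le_stringFunctionA (k : ℕ) (P : List (Strand n)) (t : Node i → ℝ) :
    -∑ d, |t d| ≤ stringFunctionA i k P t := by
  rw [stringFunctionA, ← Finset.sum_neg_distrib]
  refine Finset.sum_le_sum fun d _ => ?_
  have h1 : |coeff i k P d * t d| ≤ |t d| := by
    rw [abs_mul]
    exact mul_le_of_le_one_left (abs_nonneg _) (abs_coeff_le_one P d)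
  exact (abs_le.1 h1).1.trans' (by simp)

/-- The multiplicity of the coordinate of its layer at a node. -/
def nodeMult (d : Node i) : ℝ := if (i d.layer).val + 1 = n then 2 else 1

theorem one_le_nodeMult (d : Node i) : 1 ≤ nodeMult d := by
  unfold nodeMult
  split_ifs <;> norm_num

theorem nodeMult_le_two (d : Node i) : nodeMult d ≤ 2 := by
  unfold nodeMult
  split_ifs <;> norm_num

theorem unfoldCoords_eq (a : Fin (n ^ 2) → ℝ) (d : Node i) :
    unfoldCoords i a d = nodeMult d * a d.layer := by
  unfold unfoldCoords nodeMult
  split_ifs <;> ring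

/-- Some vector separates the string function of a symmetric path from those of all the others. -/
theorem exists_gap (hi : IsReducedWord i) {P : List (Strand n)} (hP : P ∈ rigorousPaths i n)
    (hs : IsSymmetric P) : ∃ a : Fin (n ^ 2) → ℝ, ∀ Q ∈ rigorousPaths i n, IsSymmetric Q →
      Q ≠ P → stringFunctionC i n P a + 1 / 2 ≤ stringFunctionC i n Q a := by
  classical
  -- Each node contributes at most 4 in absolute value: a coefficient difference of at most 2 times
  -- a multiplicity of at most 2.
  set C : ℝ := ∑ _d : Node i, 4 with hC
  have hC0 : 0 ≤ C := Finset.sum_nonneg fun _ _ => by norm_num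
  -- At the first difference the coefficient of `P` is 1 and can only drop, or is 0 and can only
  -- rise to 1; the sign makes either change positive.
  set σ : Fin (n ^ 2) → ℝ := fun j =>
    if ∃ d : Node i, d.layer = j ∧ coeff i n P d = 1 then -1 else 1 with hσ
  have hσabs : ∀ j, |σ j| = 1 := by
    intro j
    rw [hσ]
    dsimp only
    split_ifs <;> simp
  refine ⟨fun j => σ j * (C + 1) ^ j.rev.val, fun Q hQ hQs hne => ?_⟩
  rw [stringFunctionC, stringFunctionC, if_pos hs, if_pos hQs]
  set Y : Node i → ℝ := fun d =>
    (coeff i n Q d - coeff i n P d) * nodeMult d * σ d.layer with hY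
  set X : Fin (n ^ 2) → ℝ := fun j => ∑ d with Node.layer d = j, Y d with hX
  have hYabs : ∀ d, |Y d| ≤ 4 := by
    intro d
    have h1 := abs_sub (coeff i n Q d) (coeff i n P d)
    have h2 := abs_coeff_le_one (k := n) P d
    have h3 := abs_coeff_le_one (k := n) Q d
    have h4 := one_le_nodeMult d
    have h5 := nodeMult_le_two d
    rw [hY]
    dsimp only
    rw [abs_mul, abs_mul, hσabs, mul_one, abs_of_nonneg (by linarith : 0 ≤ nodeMult d)]
    calc _ ≤ (2 : ℝ) * 2 := mul_le_mul (by linarith) h5 (by linarith) (by norm_num)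
      _ = 4 := by norm_num
  obtain ⟨d₀, hd₀, hlow, hfirst⟩ := IsRigorousPath.exists_first_difference hi hP hQ hne.symm
  have hYnonneg : ∀ d : Node i, d.layer = d₀.layer → 0 ≤ Y d ∧
      (coeff i n P d ≠ coeff i n Q d → 1 ≤ Y d) := by
    intro d hd
    have h4 := one_le_nodeMult d
    by_cases hcd : coeff i n P d = coeff i n Q d
    · simp [hY, hcd]
    · have : 1 ≤ Y d := by
        rw [hY]
        dsimp only
        rcases hfirst d hd hcd with ⟨h1, h2⟩ | ⟨h1, h2⟩
        · have : σ d.layer = 1 := by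
            rw [hσ]
            refine if_neg ?_
            rintro ⟨e, he, he1⟩
            -- One sign must serve both nodes of a layer; symmetry of `P` guarantees that they have
            -- the same coefficient.
            rcases Node.eq_or_eq_mirror he with h | h
            · rw [h, h1] at he1
              norm_num at he1
            · rw [h, hs.coeff_mirror, h1] at he1
              norm_num at he1
          rw [this, h1, h2]
          linarith
        · have : σ d.layer = -1 := if_pos ⟨d, rfl, h1⟩
          rw [this, h1, h2]
          linarith
      exact ⟨by linarith, fun _ => this⟩
  have hmain := one_le_sum_of_first hC0 X d₀.layer ?_ ?_ ?_
  · have h1 : stringFunctionA i n Q (unfoldCoords i fun j => σ j * (C + 1) ^ j.rev.val) -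
        stringFunctionA i n P (unfoldCoords i fun j => σ j * (C + 1) ^ j.rev.val) =
        ∑ j, X j * (C + 1) ^ j.rev.val := by
      rw [stringFunctionA, stringFunctionA, ← Finset.sum_sub_distrib,
        ← Finset.sum_fiberwise Finset.univ Node.layer]
      refine Finset.sum_congr rfl fun j _ => ?_
      rw [hX, Finset.sum_mul]
      refine Finset.sum_congr rfl fun d hd => ?_
      obtain rfl := (Finset.mem_filter.1 hd).2
      rw [hY, unfoldCoords_eq]
      ring
    linarith
  · intro j hj
    refine Finset.sum_eq_zero fun d hd => ?_
    obtain rfl := (Finset.mem_filter.1 hd).2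
    simp [hY, hlow d hj]
  · refine ((hYnonneg d₀ rfl).2 hd₀).trans ?_
    refine Finset.single_le_sum (f := Y) (fun d hd => (hYnonneg d (Finset.mem_filter.1 hd).2).1) ?_
    simp
  · intro j
    have h1 : |X j| ≤ C := by
      refine (Finset.abs_sum_le_sum_abs _ _).trans ((Finset.sum_le_sum fun d _ => hYabs d).trans ?_)
      exact Finset.sum_le_sum_of_subset_of_nonneg (Finset.filter_subset _ _)
        fun _ _ _ => by norm_num
    exact (abs_le.1 h1).1

/-- Some vector takes the value `b` at all string functions of the `k`-th oriented diagram for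
`k < n`, and the value `c` at those for `k = n`. -/
theorem exists_shift (hi : IsReducedWord i) (b c : ℝ) : ∃ a : Fin (n ^ 2) → ℝ,
    (∀ k, 1 ≤ k → k < n → ∀ Q ∈ rigorousPaths i k, stringFunctionA i k Q (unfoldCoords i a) = b) ∧
    ∀ Q ∈ rigorousPaths i n, stringFunctionA i n Q (unfoldCoords i a) = c := by
  -- An odd function of the label: consecutive values differ by `b`, except across the wall, where
  -- the extra jump `c - b` makes the difference `c`.
  set h : Fin (2 * n) → ℝ := fun r => b * (r.val - n + 1 / 2) +
    if r.val < n then -((c - b) / 2) else (c - b) / 2 with hh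
  obtain ⟨a, ha⟩ := exists_unfoldCoords_eq_potentialCoords i (h := h) (by
    intro r
    have h1 : ((r.rev.val : ℕ) : ℝ) = 2 * n - 1 - r.val := by
      rw [Fin.val_rev, Nat.cast_sub (by omega)]
      push_cast
      ring
    have h2 : r.rev.val < n ↔ ¬ r.val < n := by rw [Fin.val_rev]; omega
    rw [hh]
    dsimp only
    rw [h1]
    simp only [h2]
    split_ifs <;> ring)
  refine ⟨a, fun k hk hkn Q hQ => ?_, fun Q hQ => ?_⟩
  · rw [ha, stringFunctionA_potentialCoords hi h hQ ⟨k - 1, by omega⟩ ⟨k, by omega⟩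
      (Nat.sub_add_cancel hk) rfl, hh]
    dsimp only
    rw [if_pos hkn, if_pos (by omega), Nat.cast_sub hk]
    push_cast
    ring
  · obtain ⟨x, hx, hx'⟩ := hQ.starts
    have hn : 1 ≤ n := by have := hx'.2; omega
    rw [ha, stringFunctionA_potentialCoords hi h hQ ⟨n - 1, by omega⟩ ⟨n, by omega⟩
      (Nat.sub_add_cancel hn) rfl, hh]
    dsimp only
    rw [if_neg (lt_irrefl n), if_pos (by omega), Nat.cast_sub hn]
    push_cast
    ring

/-- The existence of the starting point `L_n` rules out `n = 0`, so `(n, P)` satisfies the bound `1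
≤ k` of the index set. -/
theorem one_le_of_mem_rigorousPaths {P : List (Strand n)} (hP : P ∈ rigorousPaths i n) :
    1 ≤ n := by
  obtain ⟨x, -, hx⟩ := hP.starts
  have := hx.2
  omega

theorem isNonRedundant_of_isSymmetric (hi : IsReducedWord i) {P : List (Strand n)}
    (hP : P ∈ rigorousPaths i n) (hs : IsSymmetric P) : IsNonRedundant i n P := by
  obtain ⟨a₀, ha₀⟩ := exists_gap hi hP hs
  -- The first constant bounds every type-A function at `a₀` in absolute value. The second, once
  -- halved, moves the value of `P` to -1/4, so that the gap 1/2 lies symmetrically around 0.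
  obtain ⟨v, hv, hv'⟩ := exists_shift hi (∑ d, |unfoldCoords i a₀ d|)
    (-2 * stringFunctionC i n P a₀ - 1 / 2)
  have hsym : ∀ Q ∈ rigorousPaths i n, IsSymmetric Q → stringFunctionC i n Q (a₀ + v) =
      stringFunctionC i n Q a₀ - stringFunctionC i n P a₀ - 1 / 4 := by
    intro Q hQ hQs
    have h1 : stringFunctionC i n Q a₀ = 1 / 2 * stringFunctionA i n Q (unfoldCoords i a₀) :=
      if_pos hQs
    rw [h1, stringFunctionC, if_pos hQs, unfoldCoords_add, stringFunctionA_add, hv' Q hQ]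
    ring
  have hPval : stringFunctionC i n P (a₀ + v) = -(1 / 4) := by
    rw [hsym P hP hs]
    ring
  have hQval : ∀ Q ∈ rigorousPaths i n, IsSymmetric Q → Q ≠ P →
      1 / 4 ≤ stringFunctionC i n Q (a₀ + v) := by
    intro Q hQ hQs hne
    rw [hsym Q hQ hQs]
    linarith [ha₀ Q hQ hQs hne]
  intro heq
  have hmem : a₀ + v ∈ solutionSet i (indexSet i \ {(n, P)}) := by
    rintro ⟨k, Q⟩ ⟨⟨hk, hkn, hQ⟩, hne⟩
    dsimp only at hk hkn hQ ⊢
    rcases hkn.lt_or_eq with hkn | rfl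
    · have h1 : 0 ≤ stringFunctionA i k Q (unfoldCoords i (a₀ + v)) := by
        rw [unfoldCoords_add, stringFunctionA_add, hv k hk hkn Q hQ]
        linarith [neg_sum_abs_le_stringFunctionA k Q (unfoldCoords i a₀)]
      -- No claim about symmetry is needed for `k < n`, as a factor 1/2 does not affect the sign.
      rw [stringFunctionC]
      split_ifs
      · linarith
      · exact h1
    · have hne : Q ≠ P := fun h => hne (by rw [h]; rfl)
      by_cases hQs : IsSymmetric Q
      · linarith [hQval Q hQ hQs hne]
      -- Distinctness of the summands matters here: at most one of them is `P`, so its -1/4 is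
      -- balanced by at least 1/4.
      · obtain ⟨Q₁, hQ₁, Q₂, hQ₂, hs₁, hs₂, h12, hsum⟩ := exists_symmetric_decomposition hi hQ hQs
        rw [hsum]
        by_cases h1 : Q₁ = P
        · have h2 : Q₂ ≠ P := fun h => h12 (h1.trans h.symm)
          rw [h1, hPval]
          linarith [hQval Q₂ hQ₂ hs₂ h2]
        · by_cases h2 : Q₂ = P
          · rw [h2, hPval]
            linarith [hQval Q₁ hQ₁ hs₁ h1]
          · linarith [hQval Q₁ hQ₁ hs₁ h1, hQval Q₂ hQ₂ hs₂ h2]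
  rw [heq] at hmem
  have := hmem (n, P) ⟨one_le_of_mem_rigorousPaths hP, le_rfl, hP⟩
  dsimp only at this
  rw [hPval] at this
  norm_num at this

theorem not_isNonRedundant_of_not_isSymmetric (hi : IsReducedWord i) {P : List (Strand n)}
    (hP : P ∈ rigorousPaths i n) (hs : ¬ IsSymmetric P) : ¬ IsNonRedundant i n P := by
  obtain ⟨Q₁, hQ₁, Q₂, hQ₂, hs₁, hs₂, -, hsum⟩ := exists_symmetric_decomposition hi hP hs
  have hn := one_le_of_mem_rigorousPaths hP
  have hmem : ∀ Q ∈ rigorousPaths i n, IsSymmetric Q → (n, Q) ∈ indexSet i \ {(n, P)} := by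
    refine fun Q hQ hQs => ⟨⟨hn, le_rfl, hQ⟩, fun h => hs ?_⟩
    obtain rfl : Q = P := congrArg Prod.snd h
    exact hQs
  refine fun hne => hne (Set.Subset.antisymm (fun a ha q hq => ?_) fun a ha q hq => ha q hq.1)
  by_cases hqP : q = (n, P)
  · rw [hqP]
    dsimp only
    rw [hsum]
    exact add_nonneg (ha _ (hmem Q₁ hQ₁ hs₁)) (ha _ (hmem Q₂ hQ₂ hs₂))
  · exact ha q ⟨hq, hqP⟩

end SympString

theorem mainTheorem4 (n : ℕ) (i : Fin (n ^ 2) → Fin n) (hi : SympString.IsReducedWord i)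
    (P : List (SympString.Strand n)) (hP : P ∈ SympString.rigorousPaths i n) :
    (SympString.IsNonRedundant i n P ↔ SympString.IsSymmetric P) ∧
    (¬ SympString.IsSymmetric P →
      ∃ Q₁ ∈ SympString.rigorousPaths i n, ∃ Q₂ ∈ SympString.rigorousPaths i n,
        SympString.IsSymmetric Q₁ ∧ SympString.IsSymmetric Q₂ ∧ Q₁ ≠ Q₂ ∧
        ∀ a : Fin (n ^ 2) → ℝ,
          SympString.stringFunctionC i n P a =
            SympString.stringFunctionC i n Q₁ a + SympString.stringFunctionC i n Q₂ a) := by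
  refine ⟨⟨fun h => ?_, SympString.isNonRedundant_of_isSymmetric hi hP⟩,
    SympString.exists_symmetric_decomposition hi hP⟩
  by_contra hs
  exact SympString.not_isNonRedundant_of_not_isSymmetric hi hP hs h
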